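/- Let $k$ be an algebraically closed field of characteristic $0$, let $n=n_1+n_2$ with $n_1,n_2\ge 1$, and let $G<SL(n,k)$ be a finite group that is conjugate to a group of block diagonal matrices $\begin{pmatrix} g_1&0\\0&g_2\end{pmatrix}$ with $g_1\in SL(n_1,k)$ and $g_2\in SL(n_2,k)$. Let $V=k^n$ be the given representation, with standard basis $x_1,\dots,x_n$, let $R=k[x_1,\dots,x_n]$, and let $$T=T_{kG}(V\otimes_k kG)=T(V)\otimes_k kG,\qquad (x\otimes g)(y\otimes h)=x\,g(y)\otimes gh,$$ so that the skew-group algebra $R\#G$ is the quotient of $T$ by the commutativity relations of $R$. Let $$\omega=x_n\wedge\cdots\wedge x_1=\sum_{\sigma\in\mathfrak S_n}\operatorname{sgn}(\sigma)\,x_{\sigma(n)}\otimes\cdots\otimes x_{\sigma(1)}\in V^{\otimes n}.$$ For each irreducible representation of $G$ choose an idempotent $e_i\in kG$ such that $S_i=kGe_i$ is the corresponding simple module (one idempotent for each isomorphism class), and let $e=\sum_i e_i$. The superpotential of $eR\#Ge$ is $e(\omega\otimes 1)e\in eTe$. Let $M_G$ be the McKay quiver, with vertices $e_i$ and with $\dim_k\operatorname{Hom}_{kG}(S_j,V\otimes_k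 S_i)$ arrows $e_i\to e_j$. Then the arrows $e_i\to e_j$ can be realised as a basis of the space $e_j(V\otimes_k kG)e_i$ for all $i,j$. For every such choice of bases, $e(\omega\otimes 1)e$ is in a unique way a linear combination of paths of $M_G$ (a path being read in $eTe$ as the product of its arrows, the first arrow on the right, and a trivial path as its idempotent $e_i$). Moreover, for every vertex $e_j$ there are closed paths $p_1$ and $p_2$ at $e_j$, of lengths $n_1$ and $n_2$, such that the closed path $p=p_1p_2$ of length $n$, which passes twice through $e_j$, occurs in this linear combination with non-zero coefficient. -/

import Mathlib

open scoped TensorProduct MonoidAlgebra Matrix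

universe u v

noncomputable section

namespace SkewMcKay

variable {k : Type u} [Field k] {n : ℕ}

/-- A group `G < SL(n, k)` embeds into `SL(n₁, k) × SL(n₂, k)`, where `n₁ + n₂ = n`, if it is
conjugate to a group of block diagonal matrices with diagonal blocks in `SL(n₁, k)` and
`SL(n₂, k)`. -/
def EmbedsInProduct (G : Subgroup (Matrix.SpecialLinearGroup (Fin n) k)) (n₁ n₂ : ℕ)
    (h : n₁ + n₂ = n) : Prop :=
  ∃ P : GL (Fin n) k, ∀ g ∈ G,
    ∃ (g₁ : Matrix.SpecialLinearGroup (Fin n₁) k) (g₂ : Matrix.SpecialLinearGroup (Fin n₂) k),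
      (P : Matrix (Fin n) (Fin n) k) * (g : Matrix (Fin n) (Fin n) k)
          * ((P⁻¹ : GL (Fin n) k) : Matrix (Fin n) (Fin n) k) =
        Matrix.reindex (finSumFinEquiv.trans (finCongr h)) (finSumFinEquiv.trans (finCongr h))
          (Matrix.fromBlocks (g₁ : Matrix (Fin n₁) (Fin n₁) k) 0 0
            (g₂ : Matrix (Fin n₂) (Fin n₂) k))

/-- The given representation of `G < SL(n, k)` on `V = k ^ n`. -/
def givenRep (G : Subgroup (Matrix.SpecialLinearGroup (Fin n) k)) :
    Representation k G (Fin n → k) where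
  toFun g := Matrix.toLin' ((g : Matrix.SpecialLinearGroup (Fin n) k) : Matrix (Fin n) (Fin n) k)
  map_one' := by simp [Module.End.one_eq_id]
  map_mul' g h := by simp [Matrix.toLin'_mul, Module.End.mul_eq_comp]

/-- The diagonal action of `G` on the tensor algebra `T(V)`, by algebra automorphisms. -/
instance tensorAction (G : Subgroup (Matrix.SpecialLinearGroup (Fin n) k)) :
    MulSemiringAction G (TensorAlgebra k (Fin n → k)) where
  smul g x := TensorAlgebra.lift k ((TensorAlgebra.ι k).comp (givenRep G g)) x
  one_smul x := by
    change TensorAlgebra.lift k ((TensorAlgebra.ι k).comp (givenRep G 1)) x = AlgHom.id k _ x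
    congr 1
    ext
    simp
  mul_smul g h x := by
    change TensorAlgebra.lift k ((TensorAlgebra.ι k).comp (givenRep G (g * h))) x =
      ((TensorAlgebra.lift k ((TensorAlgebra.ι k).comp (givenRep G g))).comp
        (TensorAlgebra.lift k ((TensorAlgebra.ι k).comp (givenRep G h)))) x
    congr 1
    ext
    simp
  smul_zero g := map_zero _
  smul_add g := map_add _
  smul_one g := map_one _
  smul_mul g := map_mul _

/-- The tensor algebra `T_{kG}(V ⊗ kG)`, realised as `T(V) ⊗ kG` with the multiplication
`(x, g) (y, h) = (x g(y), g h)`. Here `SkewMonoidAlgebra.single g x` is `x ⊗ g`. The skew-group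
algebra `R # G` is its quotient by the commutativity relations of `R`. -/
abbrev TensorSmash (G : Subgroup (Matrix.SpecialLinearGroup (Fin n) k)) : Type u :=
  SkewMonoidAlgebra (TensorAlgebra k (Fin n → k)) G

/-- The inclusion of the group algebra `kG` in `T_{kG}(V ⊗ kG)` as the part of degree `0`. -/
def ofGroupAlgebra (G : Subgroup (Matrix.SpecialLinearGroup (Fin n) k)) (x : k[G]) :
    TensorSmash G :=
  x.coeff.sum fun g c => SkewMonoidAlgebra.single g (algebraMap k (TensorAlgebra k (Fin n → k)) c)

/-- `ω = x_n ∧ ⋯ ∧ x_1`, seen in `V^{⊗ n}` as the sum over all permutations `σ` of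
`sign(σ) x_{σ(n)} ⊗ ⋯ ⊗ x_{σ(1)}`, where `x_1, …, x_n` is the standard basis of `V`. -/
def omega (k : Type u) [Field k] (n : ℕ) : TensorAlgebra k (Fin n → k) :=
  ∑ σ : Equiv.Perm (Fin n), ((Equiv.Perm.sign σ : ℤ) : k) •
    TensorAlgebra.tprod k (Fin n → k) n (fun i => Pi.single (σ (Fin.rev i)) (1 : k))

/-- Idempotents `e_i` of `kG`, one for each irreducible representation: the left modules
`S_i = kG e_i` are simple, pairwise non-isomorphic, and every simple `kG`-module is isomorphic to
one of them. -/
structure IrrepIdempotents (G : Subgroup (Matrix.SpecialLinearGroup (Fin n) k)) (I : Type v) where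
  e : I → k[G]
  idem : ∀ i, IsIdempotentElem (e i)
  simple : ∀ i, IsSimpleModule k[G] (Ideal.span {e i})
  unique : ∀ i j, Nonempty (Ideal.span {e i} ≃ₗ[k[G]] Ideal.span {e j}) → i = j
  complete : ∀ (M : Type u) [AddCommGroup M] [Module k[G] M], IsSimpleModule k[G] M →
    ∃ i, Nonempty (M ≃ₗ[k[G]] Ideal.span {e i})

variable {G : Subgroup (Matrix.SpecialLinearGroup (Fin n) k)} {I : Type v}

/-- The irreducible representation of `G` on `S_i = kG e_i`. -/
def simpleRep (E : IrrepIdempotents G I) (i : I) : Representation k G (Ideal.span {E.e i}) :=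
  Representation.ofModule' (Ideal.span {E.e i})

/-- The vertices of the McKay quiver of `G`: one for each irreducible representation. -/
def McKayQuiver (_E : IrrepIdempotents G I) : Type v := I

/-- The McKay quiver has `dim Hom_{kG}(S_j, V ⊗ S_i)` arrows from `i` to `j`. -/
instance (E : IrrepIdempotents G I) : Quiver (McKayQuiver E) where
  Hom i j := Fin (Module.finrank k
    ((simpleRep E j).IntertwiningMap ((givenRep G).tprod (simpleRep E i))))

/-- The idempotent `e_i` in `T_{kG}(V ⊗ kG)`. -/
def vertexIdem (E : IrrepIdempotents G I) (i : McKayQuiver E) : TensorSmash G :=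
  ofGroupAlgebra G (E.e i)

/-- The subspace `e_j (V ⊗ kG) e_i` of `T_{kG}(V ⊗ kG)`. -/
def arrowSpace (E : IrrepIdempotents G I) (i j : McKayQuiver E) : Submodule k (TensorSmash G) :=
  Submodule.span k {y | ∃ (x : Fin n → k) (g : G),
    y = vertexIdem E j * SkewMonoidAlgebra.single g (TensorAlgebra.ι k x) * vertexIdem E i}

/-- A choice of the arrows of the McKay quiver as elements of `e (V ⊗ kG) e`: the arrows from `i`
to `j` form a basis of `e_j (V ⊗ kG) e_i`. -/
abbrev ArrowBases (E : IrrepIdempotents G I) : Type (max u v) :=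
  ∀ i j : McKayQuiver E, Module.Basis (i ⟶ j) k (arrowSpace E i j)

/-- The element of `e T_{kG}(V ⊗ kG) e` given by a path: the product of its arrows, the arrow that
is traversed first standing on the right, and the idempotent `e_i` for the trivial path at `i`. -/
def pathElement {E : IrrepIdempotents G I} (b : ArrowBases E) {i : McKayQuiver E} :
    ∀ {j : McKayQuiver E}, Quiver.Path i j → TensorSmash G
  | _, .nil => vertexIdem E i
  | _, .cons (b := l) (c := j) p a => (b l j a : TensorSmash G) * pathElement b p

/-- The path algebra `k M_G` of the McKay quiver, as a vector space: linear combinations of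
paths. -/
abbrev PathSpace (E : IrrepIdempotents G I) : Type (max u v) :=
  (Σ i j : McKayQuiver E, Quiver.Path i j) →₀ k

/-- The linear map `k M_G → e T_{kG}(V ⊗ kG) e` determined by the choice of arrows. -/
def pathMap {E : IrrepIdempotents G I} (b : ArrowBases E) : PathSpace E →ₗ[k] TensorSmash G :=
  Finsupp.linearCombination k fun p => pathElement b p.2.2

/-- The superpotential `e (ω ⊗ 1) e`, where `e` is the sum of the idempotents `e_i`. -/
def superpotential [Fintype I] (E : IrrepIdempotents G I) : TensorSmash G :=
  ofGroupAlgebra G (∑ i, E.e i) * SkewMonoidAlgebra.single 1 (omega k n) *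
    ofGroupAlgebra G (∑ i, E.e i)

end SkewMcKay

end

/-! In a basis in which `G` is block diagonal, let `F₁` be the determinant of the first `n₁`
coordinates of `n₁` vectors, and `F₂` that of the last `n₂` coordinates of `n₂` vectors. Both forms
are `G`-invariant because the blocks have determinant `1`. A `G`-invariant linear form on `T(V)`
extends to a map of `kG`-bimodules `T(V) ⊗ kG → kG` (`formExtension`). For `F = F₁F₂` the extension
of a product of elements of degrees `n₁` and `n₂` is the product of the extensions of `F₁` and `F₂`
(`formExtension_mulForm`).

Evaluate this map on `e_j ω e_j` in two ways. By bilinearity the value is `F(ω) e_j`. Here `F(ω) ≠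
0`: up to a sign it is the alternatization of `F` on the standard basis, which on an adapted basis
becomes a sum of zeros and ones in which the identity permutation contributes `1`, and the
characteristic is `0` (`alternatization_mulForm_ne_zero`). On the other hand, `e_j ω e_j` is the
part of the path expansion carried by closed paths at `e_j` of length `n`. Cut such a path as `p₁p₂`
at a vertex `e_l`. Its value `e_j F₁(p₁) e_l F₂(p₂)` vanishes for `l ≠ j` by Schur's lemma. So some
path with `l = j` has a non-zero coefficient (`exists_loops`).

The path expansion rests on three facts. The image of `e_j` identifies `Hom(S_j, V ⊗ S_i)` with `e_j
(V ⊗ kG) e_i`, so the number of arrows is right (`nonempty_arrowBases`). Paths span, because `1` is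
a combination of elements `c e_i d` and a vertex can be inserted between consecutive vectors
(`mul_mul_mem_span_pathElement`). Paths are independent, because removing arrows one at a time
yields linear forms dual to them (`pathMap_injective`). -/

noncomputable section

namespace SkewMcKay

/-! ### Idempotents with simple left ideals -/

section SimpleIdempotents

variable {k : Type u} [Field k] {A : Type*} [Ring A] [Algebra k A]

theorem mem_span_singleton_iff_mul_eq {e u : A} (he : IsIdempotentElem e) :
    u ∈ Ideal.span {e} ↔ u * e = u := by
  rw [Ideal.mem_span_singleton']
  constructor
  · rintro ⟨a, rfl⟩
    rw [mul_assoc, he.eq]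
  · exact fun h => ⟨u, h⟩

theorem ne_zero_of_isSimpleModule_span {e : A} (hs : IsSimpleModule A (Ideal.span {e})) :
    e ≠ 0 := by
  rintro rfl
  have := hs.nontrivial
  obtain ⟨x, hx⟩ := exists_ne (0 : Ideal.span {(0 : A)})
  apply hx
  ext
  simpa using x.2

/-- Right multiplication by `x * f`, as a map `A e → A f`. -/
def mulRightSpan (e f x : A) : Ideal.span {e} →ₗ[A] Ideal.span {f} where
  toFun u := ⟨u * (x * f), by
    rw [← mul_assoc]; exact Ideal.mul_mem_left _ _ (Ideal.mem_span_singleton_self f)⟩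
  map_add' u w := by ext; simp [add_mul]
  map_smul' a u := by ext; simp [mul_assoc]

/-- Schur's lemma: right multiplication by `x * f` maps `e` to `e * x * f`, and a non-zero map
between simple modules is an isomorphism. -/
theorem mul_mul_eq_zero_of_isEmpty_equiv {e f : A}
    (hse : IsSimpleModule A (Ideal.span {e})) (hsf : IsSimpleModule A (Ideal.span {f}))
    (hef : IsEmpty (Ideal.span {e} ≃ₗ[A] Ideal.span {f})) (x : A) : e * x * f = 0 := by
  rcases (mulRightSpan e f x).bijective_or_eq_zero with h | h
  · exact hef.elim (LinearEquiv.ofBijective _ h)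
  · have := congrArg Subtype.val
      (LinearMap.congr_fun h ⟨e, Ideal.mem_span_singleton_self e⟩)
    simpa [mulRightSpan, mul_assoc] using this

/-- Over an algebraically closed field the endomorphism `u ↦ u * (x * e)` of the simple module `A e`
is a scalar, which is read off at `e`. -/
theorem exists_mul_mul_eq_smul [IsAlgClosed k] [FiniteDimensional k A] {e : A}
    (hs : IsSimpleModule A (Ideal.span {e})) (x : A) :
    ∃ c : k, e * x * e = c • e := by
  have hbij := IsSimpleModule.algebraMap_end_bijective_of_isAlgClosed k (A := A)
    (V := Ideal.span {e})
  obtain ⟨c, hc⟩ := hbij.2 (mulRightSpan e e x)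
  refine ⟨c, ?_⟩
  have := congrArg Subtype.val
    (LinearMap.congr_fun hc ⟨e, Ideal.mem_span_singleton_self e⟩)
  simpa [mulRightSpan, mul_assoc] using this.symm

theorem exists_mul_eq_of_isSimpleModule_span {e u : A}
    (hs : IsSimpleModule A (Ideal.span {e})) (he : IsIdempotentElem e) (hu : u * e = u)
    (hu0 : u ≠ 0) : ∃ r : A, r * u = e := by
  have hmem := (mem_span_singleton_iff_mul_eq he).2 hu
  have := IsSimpleModule.toSpanSingleton_surjective A (m := (⟨u, hmem⟩ : Ideal.span {e}))
    (by simpa [Subtype.ext_iff] using hu0)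
  obtain ⟨r, hr⟩ := this ⟨e, Ideal.mem_span_singleton_self e⟩
  exact ⟨r, by simpa using congrArg Subtype.val hr⟩

end SimpleIdempotents

/-! ### The idempotents of the group algebra -/

section GroupAlgebra

variable {k : Type u} [Field k] {n : ℕ}
  {G : Subgroup (Matrix.SpecialLinearGroup (Fin n) k)} {I : Type v} (E : IrrepIdempotents G I)

namespace IrrepIdempotents

theorem mul_mul_eq_zero {i j : I} (h : i ≠ j) (x : k[G]) : E.e i * x * E.e j = 0 :=
  mul_mul_eq_zero_of_isEmpty_equiv (E.simple i) (E.simple j)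
    ⟨fun f => h (E.unique i j ⟨f⟩)⟩ x

theorem mul_eq_zero {i j : I} (h : i ≠ j) : E.e i * E.e j = 0 := by
  simpa using E.mul_mul_eq_zero h 1

theorem ne_zero (i : I) : E.e i ≠ 0 := ne_zero_of_isSimpleModule_span (E.simple i)

/-- If this left ideal were proper, it would lie in a maximal left ideal `m`, and `kG / m` would be
isomorphic to some `S_i`. But `e_i` annihilates `kG / m`, as every `e_i d` is in `m`, whereas it
fixes the non-zero element `e_i` of `S_i`. -/
theorem ideal_span_eq_top : Ideal.span {x : k[G] | ∃ i d, x = E.e i * d} = ⊤ := by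
  by_contra h
  obtain ⟨m, hm, hle⟩ := Ideal.exists_le_maximal _ h
  have hs : IsSimpleModule k[G] (k[G] ⧸ m) := isSimpleModule_iff_isCoatom.2 hm.out
  obtain ⟨i, ⟨φ⟩⟩ := E.complete (k[G] ⧸ m) hs
  let s : Ideal.span {E.e i} := ⟨E.e i, Ideal.mem_span_singleton_self _⟩
  obtain ⟨d, hd⟩ := Submodule.Quotient.mk_surjective m (φ.symm s)
  have h1 : E.e i • s = s := Subtype.ext (E.idem i)
  have h2 : φ.symm s = 0 := by
    rw [← h1, map_smul, ← hd, ← Submodule.Quotient.mk_smul, Submodule.Quotient.mk_eq_zero]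
    exact hle (Ideal.subset_span ⟨i, d, rfl⟩)
  exact E.ne_zero i (congrArg Subtype.val (φ.symm.map_eq_zero_iff.1 h2))

theorem one_mem_span : (1 : k[G]) ∈ Submodule.span k {x : k[G] | ∃ i c d, x = c * E.e i * d} := by
  have h1 (y : k[G]) : y ∈ Ideal.span {x : k[G] | ∃ i d, x = E.e i * d} := by
    rw [E.ideal_span_eq_top]; trivial
  generalize (1 : k[G]) = y
  induction h1 y using Submodule.span_induction with
  | mem x hx =>
    obtain ⟨i, d, rfl⟩ := hx
    exact Submodule.subset_span ⟨i, 1, d, by simp⟩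
  | zero => exact zero_mem _
  | add x y _ _ hx hy => exact add_mem hx hy
  | smul a x hx' hx =>
    clear hx'
    induction hx using Submodule.span_induction with
    | mem x hx =>
      obtain ⟨i, c, d, rfl⟩ := hx
      exact Submodule.subset_span ⟨i, a * c, d, by simp [mul_assoc]⟩
    | zero => simp
    | add x y _ _ hx hy => rw [smul_add]; exact add_mem hx hy
    | smul r x _ hx => rw [smul_comm]; exact Submodule.smul_mem _ _ hx

/-- For each `i`, a linear form on `kG` that gives the coordinate of `e_i x e_i` on `e_i`. -/
theorem exists_cornerForm [IsAlgClosed k] [Finite G] (i : I) :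
    ∃ s : k[G] →ₗ[k] k, ∀ x, E.e i * x * E.e i = s x • E.e i := by
  obtain ⟨f, hf⟩ := Module.Projective.exists_dual_ne_zero k (E.ne_zero i)
  refine ⟨(f (E.e i))⁻¹ • f ∘ₗ LinearMap.mulRight k (E.e i) ∘ₗ LinearMap.mulLeft k (E.e i),
    fun x => ?_⟩
  obtain ⟨c, hc⟩ := exists_mul_mul_eq_smul (k := k) (E.simple i) x
  simp [hc, hf, mul_comm c]

end IrrepIdempotents

end GroupAlgebra

end SkewMcKay

namespace SkewMcKay

/-! ### Left derivatives of the tensor algebra -/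

section LeftDerivative

variable {k : Type u} [Field k] {V : Type*} [AddCommGroup V] [Module k V]

/-- The representation of the tensor algebra by upper triangular matrices whose off-diagonal entry
is the left derivative along `f`. -/
def leftDerivMatrix (f : Module.Dual k V) :
    TensorAlgebra k V →ₐ[k] Matrix (Fin 2) (Fin 2) (TensorAlgebra k V) :=
  TensorAlgebra.lift k
    { toFun := fun v => !![0, algebraMap k _ (f v); 0, TensorAlgebra.ι k v]
      map_add' := fun v w => by ext i j; fin_cases i <;> fin_cases j <;> simp
      map_smul' := fun c v => by
        ext i j; fin_cases i <;> fin_cases j <;> simp [Algebra.smul_def] }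

theorem leftDerivMatrix_ι (f : Module.Dual k V) (v : V) :
    leftDerivMatrix f (TensorAlgebra.ι k v) =
      !![0, algebraMap k _ (f v); 0, TensorAlgebra.ι k v] := by
  simp [leftDerivMatrix]

theorem leftDerivMatrix_apply_one (f : Module.Dual k V) (x : TensorAlgebra k V) :
    leftDerivMatrix f x 1 0 = 0 ∧ leftDerivMatrix f x 1 1 = x := by
  induction x using TensorAlgebra.induction with
  | algebraMap r => simp [Matrix.algebraMap_matrix_apply]
  | ι v => simp [leftDerivMatrix_ι]
  | mul a b ha hb => simp [Matrix.mul_apply, ha, hb]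
  | add a b ha hb => simp [ha, hb]

/-- The left derivative of the tensor algebra along `f`, which takes `v ⊗ x` to `f v • x`. -/
def leftDeriv (f : Module.Dual k V) : TensorAlgebra k V →ₗ[k] TensorAlgebra k V where
  toFun x := leftDerivMatrix f x 0 1
  map_add' x y := by simp
  map_smul' c x := by simp

/-- The upper left entry of the matrix of a vector is `0`, so only one of the two terms of the
product rule survives. -/
theorem leftDeriv_ι_mul (f : Module.Dual k V) (v : V) (x : TensorAlgebra k V) :
    leftDeriv f (TensorAlgebra.ι k v * x) = f v • x := by
  simp [leftDeriv, Matrix.mul_apply, leftDerivMatrix_ι, leftDerivMatrix_apply_one,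
    Algebra.smul_def]

theorem leftDeriv_algebraMap (f : Module.Dual k V) (c : k) :
    leftDeriv f (algebraMap k _ c) = 0 := by
  simp [leftDeriv, Matrix.algebraMap_matrix_apply]

end LeftDerivative

/-! ### Bimodule maps, grading and coordinates on `T(V) ⊗ kG` -/

section TensorSmash

variable {k : Type u} [Field k] {n : ℕ} {G : Subgroup (Matrix.SpecialLinearGroup (Fin n) k)}

theorem smul_eq_lift (g : G) (x : TensorAlgebra k (Fin n → k)) :
    g • x = TensorAlgebra.lift k ((TensorAlgebra.ι k).comp (givenRep G g)) x := rfl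

theorem smul_ι (g : G) (x : Fin n → k) :
    g • TensorAlgebra.ι k x = TensorAlgebra.ι k (givenRep G g x) := by
  simp [smul_eq_lift]

theorem smul_tprod (g : G) {m : ℕ} (x : Fin m → Fin n → k) :
    g • TensorAlgebra.tprod k (Fin n → k) m x =
      TensorAlgebra.tprod k (Fin n → k) m (fun i => givenRep G g (x i)) := by
  simp only [smul_eq_lift, TensorAlgebra.tprod_apply, map_list_prod, List.map_ofFn]
  congr 2
  ext i
  simp

instance smulCommClass_tensorAlgebra : SMulCommClass G k (TensorAlgebra k (Fin n → k)) where
  smul_comm g c x := by simp [smul_eq_lift]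

variable (G) in
/-- The inclusion of `kG` in `T(V) ⊗ kG` as a homomorphism of algebras. -/
def groupInclusion : k[G] →ₐ[k] TensorSmash G :=
  MonoidAlgebra.lift k (TensorSmash G) G (SkewMonoidAlgebra.of (TensorAlgebra k (Fin n → k)) G)

theorem groupInclusion_single (g : G) (c : k) :
    groupInclusion G (MonoidAlgebra.single g c) =
      SkewMonoidAlgebra.single g (algebraMap k (TensorAlgebra k (Fin n → k)) c) := by
  simp [groupInclusion, SkewMonoidAlgebra.of_apply, Algebra.algebraMap_eq_smul_one,
    SkewMonoidAlgebra.smul_single]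

theorem ofGroupAlgebra_eq (x : k[G]) : ofGroupAlgebra G x = groupInclusion G x := by
  simp [ofGroupAlgebra, groupInclusion, MonoidAlgebra.lift_apply, SkewMonoidAlgebra.of_apply,
    Algebra.algebraMap_eq_smul_one, SkewMonoidAlgebra.smul_single]

theorem single_mul_single' (g h : G) (x y : TensorAlgebra k (Fin n → k)) :
    (SkewMonoidAlgebra.single g x * SkewMonoidAlgebra.single h y : TensorSmash G) =
      SkewMonoidAlgebra.single (g * h) (x * g • y) :=
  SkewMonoidAlgebra.single_mul_single

/-- The extension of a linear form on `T(V)` to a map from `T(V) ⊗ kG` to `kG`. -/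
def formExtension (F : TensorAlgebra k (Fin n → k) →ₗ[k] k) : TensorSmash G →ₗ[k] k[G] :=
  (MonoidAlgebra.coeffLinearEquiv k).symm.toLinearMap ∘ₗ Finsupp.mapRange.linearMap F ∘ₗ
    (SkewMonoidAlgebra.coeffLinearEquiv (S := k)).toLinearMap

theorem formExtension_single (F : TensorAlgebra k (Fin n → k) →ₗ[k] k) (g : G)
    (x : TensorAlgebra k (Fin n → k)) :
    formExtension F (SkewMonoidAlgebra.single g x) = MonoidAlgebra.single g (F x) := by
  ext a
  change (Finsupp.mapRange.linearMap F (Finsupp.single g x)) a = _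
  simp

theorem induction_single {p : TensorSmash G → Prop} (t : TensorSmash G)
    (single : ∀ g x, p (SkewMonoidAlgebra.single g x))
    (add : ∀ s t, p s → p t → p (s + t)) : p t :=
  SkewMonoidAlgebra.induction_on' t single (fun _ _ => add _ _)

/-- Moving `g` to the right past `x` turns `x` into `g x`, which an invariant form does not notice.
On the other side nothing is moved past `x`, so the right-handed version holds for every form. -/
theorem formExtension_groupInclusion_mul {F : TensorAlgebra k (Fin n → k) →ₗ[k] k}
    (hF : ∀ (g : G) x, F (g • x) = F x) (a : k[G]) (t : TensorSmash G) :
    formExtension F (groupInclusion G a * t) = a * formExtension F t := by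
  induction a using MonoidAlgebra.induction_linear with
  | zero => simp
  | add a b ha hb => simp [add_mul, ha, hb]
  | single g c =>
    induction t using induction_single with
    | add s t hs ht => simp [mul_add, hs, ht]
    | single h x =>
      rw [groupInclusion_single, single_mul_single', formExtension_single, formExtension_single,
        MonoidAlgebra.single_mul_single, ← Algebra.smul_def, map_smul, hF, smul_eq_mul]

theorem formExtension_mul_groupInclusion (F : TensorAlgebra k (Fin n → k) →ₗ[k] k)
    (a : k[G]) (t : TensorSmash G) :
    formExtension F (t * groupInclusion G a) = formExtension F t * a := by
  induction a using MonoidAlgebra.induction_linear with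
  | zero => simp
  | add a b ha hb => simp [mul_add, ha, hb]
  | single g c =>
    induction t using induction_single with
    | add s t hs ht => simp [add_mul, hs, ht]
    | single h x =>
      rw [groupInclusion_single, single_mul_single', formExtension_single, formExtension_single,
        MonoidAlgebra.single_mul_single, smul_algebraMap, ← Algebra.commutes, ← Algebra.smul_def,
        map_smul, smul_eq_mul, mul_comm]

/-- The projection of `T(V) ⊗ kG` on its part `kG` of degree `0`. -/
def degreeZero : TensorSmash G →ₗ[k] k[G] :=
  formExtension TensorAlgebra.algebraMapInv.toLinearMap

theorem degreeZero_groupInclusion (a : k[G]) : degreeZero (groupInclusion G a) = a := by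
  induction a using MonoidAlgebra.induction_linear with
  | zero => simp
  | add a b ha hb => simp [ha, hb]
  | single g c => simp [groupInclusion_single, degreeZero, formExtension_single]

/-- The vector `v` as the element `v ⊗ 1` of `T(V) ⊗ kG`. -/
def vector (v : Fin n → k) : TensorSmash G :=
  SkewMonoidAlgebra.single 1 (TensorAlgebra.ι k v)

theorem vector_mul_single (v : Fin n → k) (g : G) (x : TensorAlgebra k (Fin n → k)) :
    vector v * SkewMonoidAlgebra.single g x =
      SkewMonoidAlgebra.single g (TensorAlgebra.ι k v * x) := by
  simp [vector]

theorem degreeZero_vector_mul (v : Fin n → k) (t : TensorSmash G) :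
    degreeZero (vector v * t) = 0 := by
  induction t using induction_single with
  | add s t hs ht => simp [mul_add, hs, ht]
  | single h x =>
    rw [vector_mul_single, degreeZero, formExtension_single]
    simp [TensorAlgebra.algebraMapInv]

/-- The left derivative of `T(V) ⊗ kG` along `f`, which takes `v ⊗ x ⊗ g` to `f v • x ⊗ g`. -/
def smashDeriv (f : Module.Dual k (Fin n → k)) : TensorSmash G →ₗ[k] TensorSmash G :=
  (SkewMonoidAlgebra.coeffLinearEquiv (S := k)).symm.toLinearMap ∘ₗ
    Finsupp.mapRange.linearMap (leftDeriv f) ∘ₗ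
    (SkewMonoidAlgebra.coeffLinearEquiv (S := k)).toLinearMap

theorem smashDeriv_single (f : Module.Dual k (Fin n → k)) (g : G)
    (x : TensorAlgebra k (Fin n → k)) :
    smashDeriv f (SkewMonoidAlgebra.single g x) = SkewMonoidAlgebra.single g (leftDeriv f x) := by
  ext a
  change (Finsupp.mapRange.linearMap (leftDeriv f) (Finsupp.single g x)) a =
    Finsupp.single g (leftDeriv f x) a
  simp

theorem smashDeriv_vector_mul (f : Module.Dual k (Fin n → k)) (v : Fin n → k)
    (t : TensorSmash G) : smashDeriv f (vector v * t) = f v • t := by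
  induction t using induction_single with
  | add s t hs ht => simp [mul_add, hs, ht]
  | single h x =>
    rw [vector_mul_single, smashDeriv_single, leftDeriv_ι_mul, SkewMonoidAlgebra.smul_single]

theorem smashDeriv_groupInclusion (f : Module.Dual k (Fin n → k)) (a : k[G]) :
    smashDeriv f (groupInclusion G a) = 0 := by
  induction a using MonoidAlgebra.induction_linear with
  | zero => simp
  | add a b ha hb => simp [ha, hb]
  | single g c => simp [groupInclusion_single, smashDeriv_single, leftDeriv_algebraMap]

variable (k G) in
/-- The homogeneous part of degree `m` of `T(V) ⊗ kG`. -/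
def homogeneousPart (m : ℕ) : Submodule k (TensorSmash G) :=
  Submodule.span k {y | ∃ (g : G) (x : Fin m → Fin n → k),
    y = SkewMonoidAlgebra.single g (TensorAlgebra.tprod k (Fin n → k) m x)}

theorem tprod_mul_tprod {a b : ℕ} (x : Fin a → Fin n → k) (y : Fin b → Fin n → k) :
    TensorAlgebra.tprod k (Fin n → k) a x * TensorAlgebra.tprod k (Fin n → k) b y =
      TensorAlgebra.tprod k (Fin n → k) (a + b) (Fin.append x y) := by
  simp only [TensorAlgebra.tprod_apply, ← List.prod_append, ← List.ofFn_fin_append]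
  congr 2
  ext i
  refine Fin.addCases (fun i => ?_) (fun i => ?_) i <;> simp

theorem mul_mem_homogeneousPart {a b : ℕ} {s t : TensorSmash G}
    (hs : s ∈ homogeneousPart k G a) (ht : t ∈ homogeneousPart k G b) :
    s * t ∈ homogeneousPart k G (a + b) := by
  induction hs, ht using Submodule.span_induction₂ with
  | mem_mem s t hs ht =>
    obtain ⟨g, x, rfl⟩ := hs
    obtain ⟨h, y, rfl⟩ := ht
    rw [single_mul_single', smul_tprod, tprod_mul_tprod]
    exact Submodule.subset_span ⟨_, _, rfl⟩
  | zero_left => simp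
  | zero_right => simp
  | add_left x y z _ _ _ h1 h2 => rw [add_mul]; exact add_mem h1 h2
  | add_right x y z _ _ _ h1 h2 => rw [mul_add]; exact add_mem h1 h2
  | smul_left r x y _ _ h => rw [smul_mul_assoc]; exact Submodule.smul_mem _ _ h
  | smul_right r x y _ _ h => rw [mul_smul_comm]; exact Submodule.smul_mem _ _ h

theorem groupInclusion_mem_homogeneousPart (a : k[G]) :
    groupInclusion G a ∈ homogeneousPart k G 0 := by
  induction a using MonoidAlgebra.induction_linear with
  | zero => simp
  | add a b ha hb => rw [map_add]; exact add_mem ha hb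
  | single g c =>
    rw [groupInclusion_single, Algebra.algebraMap_eq_smul_one, ← SkewMonoidAlgebra.smul_single]
    exact Submodule.smul_mem _ _ (Submodule.subset_span ⟨g, ![], by simp⟩)

theorem groupInclusion_mul_mem_homogeneousPart (a : k[G]) {m : ℕ} {t : TensorSmash G}
    (ht : t ∈ homogeneousPart k G m) : groupInclusion G a * t ∈ homogeneousPart k G m := by
  have h := mul_mem_homogeneousPart (groupInclusion_mem_homogeneousPart a) ht
  rwa [zero_add] at h

theorem mul_groupInclusion_mem_homogeneousPart (a : k[G]) {m : ℕ} {t : TensorSmash G}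
    (ht : t ∈ homogeneousPart k G m) : t * groupInclusion G a ∈ homogeneousPart k G m := by
  have h := mul_mem_homogeneousPart ht (groupInclusion_mem_homogeneousPart a)
  rwa [add_zero] at h

theorem exists_groupInclusion_eq {t : TensorSmash G} (ht : t ∈ homogeneousPart k G 0) :
    ∃ a, groupInclusion G a = t := by
  induction ht using Submodule.span_induction with
  | mem t ht =>
    obtain ⟨g, x, rfl⟩ := ht
    exact ⟨MonoidAlgebra.single g 1, by simp [groupInclusion_single]⟩
  | zero => exact ⟨0, map_zero _⟩
  | add s t _ _ hs ht =>
    obtain ⟨a, rfl⟩ := hs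
    obtain ⟨b, rfl⟩ := ht
    exact ⟨a + b, map_add _ _ _⟩
  | smul c t _ ht =>
    obtain ⟨a, rfl⟩ := ht
    exact ⟨c • a, map_smul _ _ _⟩

theorem single_ι_mem_homogeneousPart (g : G) (v : Fin n → k) :
    SkewMonoidAlgebra.single g (TensorAlgebra.ι k v) ∈ homogeneousPart k G 1 :=
  Submodule.subset_span ⟨g, ![v], by simp⟩

theorem single_tprod_succ (g : G) {m : ℕ} (x : Fin (m + 1) → Fin n → k) :
    SkewMonoidAlgebra.single g (TensorAlgebra.tprod k (Fin n → k) (m + 1) x) =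
      vector (x 0) *
        SkewMonoidAlgebra.single g (TensorAlgebra.tprod k (Fin n → k) m (Fin.tail x)) := by
  rw [vector_mul_single]
  simp [TensorAlgebra.tprod_apply, List.ofFn_succ, Fin.tail]

theorem vector_mul_groupInclusion_single (v : Fin n → k) (g : G) :
    vector v * groupInclusion G (MonoidAlgebra.single g 1) =
      SkewMonoidAlgebra.single g (TensorAlgebra.ι k v) := by
  rw [groupInclusion_single, vector_mul_single, map_one, mul_one]

theorem vector_mem_homogeneousPart (v : Fin n → k) :
    (vector v : TensorSmash G) ∈ homogeneousPart k G 1 :=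
  single_ι_mem_homogeneousPart 1 v

/-- The part of degree `1` is generated by the standard basis vectors as a right `kG`-module. The
coefficients are recovered by `coordinate`, so it is free on them. -/
theorem eq_sum_vector_mul {u : TensorSmash G} (hu : u ∈ homogeneousPart k G 1) :
    ∃ c : Fin n → k[G], u = ∑ i, vector (Pi.single i 1) * groupInclusion G (c i) := by
  induction hu using Submodule.span_induction with
  | mem t ht =>
    obtain ⟨g, x, rfl⟩ := ht
    refine ⟨fun i => MonoidAlgebra.single g (x 0 i), ?_⟩
    simp only [groupInclusion_single, vector_mul_single]
    have h : TensorAlgebra.tprod k (Fin n → k) 1 x = ∑ i,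
        TensorAlgebra.ι k (Pi.single i (1 : k)) * algebraMap k _ (x 0 i) := by
      conv_lhs => rw [TensorAlgebra.tprod_apply]
      simp only [List.ofFn_succ, List.ofFn_zero, List.prod_singleton]
      conv_lhs => rw [pi_eq_sum_univ' (x 0)]
      simp [← Algebra.commutes, ← Algebra.smul_def]
    rw [h]
    exact map_sum (SkewMonoidAlgebra.singleAddHom g) _ _
  | zero => exact ⟨0, by simp⟩
  | add s t _ _ hs ht =>
    obtain ⟨a, rfl⟩ := hs
    obtain ⟨b, rfl⟩ := ht
    exact ⟨a + b, by simp [mul_add, Finset.sum_add_distrib]⟩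
  | smul c t _ ht =>
    obtain ⟨a, rfl⟩ := ht
    exact ⟨c • a, by simp [Finset.smul_sum]⟩

/-- The derivative only touches the first tensor factor, which is supplied by `u`. -/
theorem smashDeriv_mul {u : TensorSmash G} (hu : u ∈ homogeneousPart k G 1)
    (f : Module.Dual k (Fin n → k)) (t : TensorSmash G) :
    smashDeriv f (u * t) = smashDeriv f u * t := by
  obtain ⟨c, rfl⟩ := eq_sum_vector_mul hu
  simp [Finset.sum_mul, mul_assoc, smashDeriv_vector_mul]

/-- The coefficient in `kG` of an element of degree `1` on the `x`-th vector of the standard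
basis. -/
def coordinate (x : Fin n) : TensorSmash G →ₗ[k] k[G] :=
  degreeZero ∘ₗ smashDeriv (LinearMap.proj x)

theorem coordinate_sum_vector_mul (c : Fin n → k[G]) (x : Fin n) :
    coordinate x (∑ i, vector (Pi.single i 1) * groupInclusion G (c i)) = c x := by
  simp only [coordinate, map_sum, LinearMap.comp_apply, smashDeriv_vector_mul, map_smul,
    degreeZero_groupInclusion]
  simp [Pi.single_apply]

theorem sum_vector_mul_coordinate {u : TensorSmash G} (hu : u ∈ homogeneousPart k G 1) :
    ∑ i, vector (Pi.single i 1) * groupInclusion G (coordinate i u) = u := by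
  obtain ⟨c, rfl⟩ := eq_sum_vector_mul hu
  simp only [coordinate_sum_vector_mul]

theorem groupInclusion_coordinate {u : TensorSmash G} (hu : u ∈ homogeneousPart k G 1)
    (x : Fin n) : groupInclusion G (coordinate x u) = smashDeriv (LinearMap.proj x) u := by
  obtain ⟨c, rfl⟩ := eq_sum_vector_mul hu
  rw [coordinate_sum_vector_mul]
  simp [smashDeriv_vector_mul, Pi.single_apply]

theorem coordinate_mul_groupInclusion (x : Fin n) {u : TensorSmash G}
    (hu : u ∈ homogeneousPart k G 1) (a : k[G]) :
    coordinate x (u * groupInclusion G a) = coordinate x u * a := by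
  rw [coordinate, LinearMap.comp_apply, smashDeriv_mul hu, degreeZero,
    formExtension_mul_groupInclusion]
  rfl

instance finiteDimensional_homogeneousPart_one [Finite G] :
    FiniteDimensional k (homogeneousPart k G 1) := by
  let L : (Fin n → k[G]) →ₗ[k] TensorSmash G :=
    { toFun := fun c => ∑ i, vector (Pi.single i 1) * groupInclusion G (c i)
      map_add' := fun a b => by simp [mul_add, Finset.sum_add_distrib]
      map_smul' := fun a b => by simp [Finset.smul_sum] }
  have h : homogeneousPart k G 1 ≤ LinearMap.range L := fun u hu =>
    ⟨fun i => coordinate i u, sum_vector_mul_coordinate hu⟩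
  exact Submodule.finiteDimensional_of_le h

end TensorSmash

end SkewMcKay

/-! ### Arrow spaces and the existence of arrow bases -/

namespace SkewMcKay

variable {k : Type u} [Field k] {n : ℕ} {G : Subgroup (Matrix.SpecialLinearGroup (Fin n) k)}
  {I : Type v} (E : IrrepIdempotents G I)

theorem vertexIdem_eq (i : McKayQuiver E) : vertexIdem E i = groupInclusion G (E.e i) :=
  ofGroupAlgebra_eq _

theorem vertexIdem_mul_self (i : McKayQuiver E) :
    vertexIdem E i * vertexIdem E i = vertexIdem E i := by
  rw [vertexIdem_eq, ← map_mul, (E.idem i).eq]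

theorem vertexIdem_mul_eq_zero {i j : McKayQuiver E} (h : i ≠ j) :
    vertexIdem E i * vertexIdem E j = 0 := by
  rw [vertexIdem_eq, vertexIdem_eq, ← map_mul, E.mul_eq_zero h, map_zero]

theorem mul_mul_mem_arrowSpace (i j : McKayQuiver E) {u : TensorSmash G}
    (hu : u ∈ homogeneousPart k G 1) :
    vertexIdem E j * u * vertexIdem E i ∈ arrowSpace E i j := by
  induction hu using Submodule.span_induction with
  | mem t ht =>
    obtain ⟨g, x, rfl⟩ := ht
    exact Submodule.subset_span ⟨x 0, g, by simp⟩
  | zero => simp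
  | add s t _ _ hs ht => rw [mul_add, add_mul]; exact add_mem hs ht
  | smul c t _ ht => rw [mul_smul_comm, smul_mul_assoc]; exact Submodule.smul_mem _ _ ht

theorem mem_arrowSpace_iff {i j : McKayQuiver E} {u : TensorSmash G} :
    u ∈ arrowSpace E i j ↔ u ∈ homogeneousPart k G 1 ∧ vertexIdem E j * u = u ∧
      u * vertexIdem E i = u := by
  constructor
  · intro hu
    induction hu using Submodule.span_induction with
    | mem u hu =>
      obtain ⟨x, g, rfl⟩ := hu
      refine ⟨?_, ?_, ?_⟩
      · rw [vertexIdem_eq, vertexIdem_eq]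
        exact mul_groupInclusion_mem_homogeneousPart _
          (groupInclusion_mul_mem_homogeneousPart _ (single_ι_mem_homogeneousPart g x))
      · simp only [← mul_assoc, vertexIdem_mul_self]
      · simp only [mul_assoc, vertexIdem_mul_self]
    | zero => simp
    | add s t _ _ hs ht =>
      exact ⟨add_mem hs.1 ht.1, by rw [mul_add, hs.2.1, ht.2.1], by rw [add_mul, hs.2.2, ht.2.2]⟩
    | smul c t _ ht =>
      exact ⟨Submodule.smul_mem _ _ ht.1, by rw [mul_smul_comm, ht.2.1],
        by rw [smul_mul_assoc, ht.2.2]⟩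
  · rintro ⟨h1, h2, h3⟩
    rw [← h3, ← h2]
    exact mul_mul_mem_arrowSpace E i j h1

instance finiteDimensional_arrowSpace [Finite G] (i j : McKayQuiver E) :
    FiniteDimensional k (arrowSpace E i j) :=
  Submodule.finiteDimensional_of_le (S₂ := homogeneousPart k G 1)
    fun _ hu => ((mem_arrowSpace_iff E).1 hu).1

section ArrowBases

/-- The inclusion of `V ⊗ S_i` in `T(V) ⊗ kG`. -/
def tensorInclusion (i : McKayQuiver E) :
    (Fin n → k) ⊗[k] Ideal.span {E.e i} →ₗ[k] TensorSmash G :=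
  TensorProduct.lift <| LinearMap.mk₂ k
    (fun v s => vector v * groupInclusion G (s : k[G]))
    (fun v w s => by simp [vector, SkewMonoidAlgebra.single_add, add_mul])
    (fun c v s => by simp [vector, ← SkewMonoidAlgebra.smul_single])
    (fun v s t => by simp [mul_add])
    (fun c v s => by simp)

theorem tensorInclusion_tmul (i : McKayQuiver E) (v : Fin n → k) (s : Ideal.span {E.e i}) :
    tensorInclusion E i (v ⊗ₜ s) = vector v * groupInclusion G (s : k[G]) := rfl

theorem tensorInclusion_injective (i : McKayQuiver E) :
    Function.Injective (tensorInclusion E i) := by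
  have h (t : (Fin n → k) ⊗[k] Ideal.span {E.e i}) :
      ∃ s : Fin n → Ideal.span {E.e i}, t = ∑ x, Pi.single x 1 ⊗ₜ s x := by
    induction t using TensorProduct.induction_on with
    | zero => exact ⟨0, by simp⟩
    | add a b ha hb =>
      obtain ⟨s, rfl⟩ := ha
      obtain ⟨t, rfl⟩ := hb
      exact ⟨s + t, by simp [TensorProduct.tmul_add, Finset.sum_add_distrib]⟩
    | tmul v s =>
      refine ⟨fun x => v x • s, ?_⟩
      conv_lhs => rw [pi_eq_sum_univ' v, TensorProduct.sum_tmul]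
      simp [TensorProduct.smul_tmul]
  rw [injective_iff_map_eq_zero]
  intro t ht
  obtain ⟨s, rfl⟩ := h t
  simp only [map_sum, tensorInclusion_tmul] at ht
  refine Finset.sum_eq_zero fun x _ => ?_
  have := coordinate_sum_vector_mul (G := G) (fun i => (s i : k[G])) x
  rw [ht, map_zero] at this
  rw [show s x = 0 from Subtype.ext this.symm, TensorProduct.tmul_zero]

theorem mem_range_tensorInclusion {i : McKayQuiver E} {u : TensorSmash G} :
    u ∈ LinearMap.range (tensorInclusion E i) ↔
      u ∈ homogeneousPart k G 1 ∧ u * vertexIdem E i = u := by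
  constructor
  · rintro ⟨t, rfl⟩
    induction t using TensorProduct.induction_on with
    | zero => simp
    | add a b ha hb =>
      rw [map_add]
      exact ⟨add_mem ha.1 hb.1, by rw [add_mul, ha.2, hb.2]⟩
    | tmul v s =>
      rw [tensorInclusion_tmul]
      refine ⟨mul_groupInclusion_mem_homogeneousPart _ (vector_mem_homogeneousPart v), ?_⟩
      rw [vertexIdem_eq, mul_assoc, ← map_mul,
        (mem_span_singleton_iff_mul_eq (E.idem i)).1 s.2]
  · rintro ⟨h1, h2⟩
    rw [← h2, ← sum_vector_mul_coordinate h1]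
    refine ⟨∑ x, Pi.single x 1 ⊗ₜ ⟨coordinate x u * E.e i,
      Ideal.mul_mem_left _ _ (Ideal.mem_span_singleton_self _)⟩, ?_⟩
    simp [tensorInclusion_tmul, Finset.sum_mul, mul_assoc, vertexIdem_eq]

theorem coe_simpleRep (i : McKayQuiver E) (g : G) (s : Ideal.span {E.e i}) :
    ((simpleRep E i g s : Ideal.span {E.e i}) : k[G]) = MonoidAlgebra.single g 1 * (s : k[G]) := by
  simp [simpleRep, Representation.ofModule']

theorem single_mul_vector (g : G) (v : Fin n → k) :
    groupInclusion G (MonoidAlgebra.single g 1) * vector v =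
      vector (givenRep G g v) * groupInclusion G (MonoidAlgebra.single g 1) := by
  rw [vector_mul_groupInclusion_single, vector, groupInclusion_single, single_mul_single', smul_ι]
  simp

theorem tensorInclusion_tprod (i : McKayQuiver E) (g : G)
    (t : (Fin n → k) ⊗[k] Ideal.span {E.e i}) :
    tensorInclusion E i ((givenRep G).tprod (simpleRep E i) g t) =
      groupInclusion G (MonoidAlgebra.single g 1) * tensorInclusion E i t := by
  induction t using TensorProduct.induction_on with
  | zero => simp
  | add a b ha hb => simp only [map_add, mul_add, ha, hb]
  | tmul v s =>
    rw [Representation.tprod_apply, TensorProduct.map_tmul, tensorInclusion_tmul,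
      tensorInclusion_tmul, coe_simpleRep, map_mul, ← mul_assoc, ← mul_assoc, single_mul_vector]

theorem tensorInclusion_intertwiningMap {i j : McKayQuiver E}
    (f : (simpleRep E j).IntertwiningMap ((givenRep G).tprod (simpleRep E i))) (a : k[G])
    (s : Ideal.span {E.e j}) :
    tensorInclusion E i (f (a • s)) = groupInclusion G a * tensorInclusion E i (f s) := by
  induction a using MonoidAlgebra.induction_linear with
  | zero => simp
  | add a b ha hb => simp only [add_smul, map_add, add_mul, ha, hb]
  | single g c =>
    have h1 : (MonoidAlgebra.single g c : k[G]) = c • MonoidAlgebra.single g 1 := by simp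
    have h2 : (MonoidAlgebra.single g (1 : k)) • s = simpleRep E j g s :=
      Subtype.ext (coe_simpleRep E j g s).symm
    rw [h1, smul_assoc, h2, map_smul, map_smul, map_smul, smul_mul_assoc, f.isIntertwining,
      tensorInclusion_tprod]

/-- The generator `e_j` of `S_j`. -/
def generator (j : McKayQuiver E) : Ideal.span {E.e j} :=
  ⟨E.e j, Ideal.mem_span_singleton_self _⟩

theorem smul_generator (j : McKayQuiver E) (s : Ideal.span {E.e j}) :
    (s : k[G]) • generator E j = s :=
  Subtype.ext ((mem_span_singleton_iff_mul_eq (E.idem j)).1 s.2)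

/-- The map from `Hom_{kG}(S_j, V ⊗ S_i)` to `e_j (V ⊗ kG) e_i` given by the image of `e_j`. -/
def evalGenerator (i j : McKayQuiver E) :
    (simpleRep E j).IntertwiningMap ((givenRep G).tprod (simpleRep E i)) →ₗ[k]
      arrowSpace E i j where
  toFun f := ⟨tensorInclusion E i (f (generator E j)), by
    have h := (mem_range_tensorInclusion E (i := i)).1 ⟨f (generator E j), rfl⟩
    refine (mem_arrowSpace_iff E).2 ⟨h.1, ?_, h.2⟩
    rw [vertexIdem_eq, ← tensorInclusion_intertwiningMap]
    exact congrArg (fun s => tensorInclusion E i (f s)) (smul_generator E j (generator E j))⟩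
  map_add' f g := by ext1; exact map_add (tensorInclusion E i) _ _
  map_smul' c f := by ext1; exact map_smul (tensorInclusion E i) _ _

theorem evalGenerator_injective (i j : McKayQuiver E) :
    Function.Injective (evalGenerator E i j) := by
  rw [injective_iff_map_eq_zero]
  intro f hf
  have h0 : tensorInclusion E i (f (generator E j)) = 0 := congrArg Subtype.val hf
  refine Representation.IntertwiningMap.ext (LinearMap.ext fun s => ?_)
  change f s = 0
  apply tensorInclusion_injective E i
  rw [← smul_generator E j s, tensorInclusion_intertwiningMap, h0, mul_zero, map_zero]

theorem evalGenerator_surjective (i j : McKayQuiver E) :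
    Function.Surjective (evalGenerator E i j) := by
  rintro ⟨w, hw⟩
  obtain ⟨hw1, hw2, hw3⟩ := (mem_arrowSpace_iff E).1 hw
  have hmem (a : k[G]) : groupInclusion G a * w ∈ LinearMap.range (tensorInclusion E i) := by
    refine (mem_range_tensorInclusion E).2 ⟨groupInclusion_mul_mem_homogeneousPart a hw1,
      by rw [mul_assoc, hw3]⟩
  -- The preimage of `w` is the intertwiner `s ↦ s w`. It takes values in `(V ⊗ kG) e_i`, which is
  -- the image of `V ⊗ S_i`, and sends `e_j` to `e_j w = w`.
  let L : Ideal.span {E.e j} →ₗ[k] LinearMap.range (tensorInclusion E i) :=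
    { toFun := fun s => ⟨groupInclusion G (s : k[G]) * w, hmem _⟩
      map_add' := fun s t => by ext1; simp [add_mul]
      map_smul' := fun c s => by ext1; simp }
  let φ := LinearEquiv.ofInjective _ (tensorInclusion_injective E i)
  have hφ (s) : tensorInclusion E i (φ.symm (L s)) = groupInclusion G (s : k[G]) * w :=
    congrArg Subtype.val (φ.apply_symm_apply (L s))
  refine ⟨LinearMap.intertwiningMap_of_isIntertwiningMap _ _ (φ.symm.toLinearMap ∘ₗ L) ?_, ?_⟩
  · intro g s
    apply tensorInclusion_injective E i
    rw [tensorInclusion_tprod]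
    change tensorInclusion E i (φ.symm (L _)) = _ * tensorInclusion E i (φ.symm (L _))
    rw [hφ, hφ, coe_simpleRep, map_mul, mul_assoc]
  · ext1
    refine (hφ (generator E j)).trans ?_
    rw [vertexIdem_eq] at hw2
    exact hw2

theorem nonempty_arrowBases [Finite G] : Nonempty (ArrowBases E) :=
  ⟨fun i j =>
    let φ := LinearEquiv.ofBijective (evalGenerator E i j)
      ⟨evalGenerator_injective E i j, evalGenerator_surjective E i j⟩
    haveI : Module.Free k (arrowSpace E i j) :=
      @Module.Free.of_divisionRing k (arrowSpace E i j) _ _ _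
    Module.finBasisOfFinrankEq k (arrowSpace E i j) φ.finrank_eq.symm⟩

end ArrowBases

end SkewMcKay

/-! ### Paths form a basis: dual linear forms and spanning -/

namespace SkewMcKay

variable {k : Type u} [Field k] {n : ℕ} {G : Subgroup (Matrix.SpecialLinearGroup (Fin n) k)}
  {I : Type v} (E : IrrepIdempotents G I)

instance fintypeArrows (i j : McKayQuiver E) : Fintype (i ⟶ j) :=
  inferInstanceAs (Fintype (Fin _))

theorem coordinate_mul_idem {i j : McKayQuiver E} {u : TensorSmash G}
    (hu : u ∈ arrowSpace E i j) (x : Fin n) : coordinate x u * E.e i = coordinate x u := by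
  obtain ⟨h1, -, h3⟩ := (mem_arrowSpace_iff E).1 hu
  rw [← coordinate_mul_groupInclusion x h1]
  rw [vertexIdem_eq] at h3
  exact congrArg (coordinate x) h3

section PathElement

variable {E}

theorem vertexIdem_mul_pathElement (b : ArrowBases E) {i j : McKayQuiver E}
    (p : Quiver.Path i j) : vertexIdem E j * pathElement b p = pathElement b p := by
  cases p with
  | nil => exact vertexIdem_mul_self E i
  | cons p a =>
    rw [pathElement, ← mul_assoc, ((mem_arrowSpace_iff E).1 (b _ _ a).2).2.1]

theorem pathElement_mul_vertexIdem (b : ArrowBases E) {i j : McKayQuiver E}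
    (p : Quiver.Path i j) : pathElement b p * vertexIdem E i = pathElement b p := by
  induction p with
  | nil => exact vertexIdem_mul_self E i
  | cons p a ih => rw [pathElement, mul_assoc, ih]

theorem pathElement_mem_homogeneousPart (b : ArrowBases E) {i j : McKayQuiver E}
    (p : Quiver.Path i j) : pathElement b p ∈ homogeneousPart k G p.length := by
  induction p with
  | nil =>
    rw [pathElement, vertexIdem_eq]
    exact groupInclusion_mem_homogeneousPart _
  | cons p a ih =>
    rw [pathElement, Quiver.Path.length_cons, add_comm]
    exact mul_mem_homogeneousPart ((mem_arrowSpace_iff E).1 (b _ _ a).2).1 ih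

theorem pathElement_comp (b : ArrowBases E) {i j l : McKayQuiver E}
    (p : Quiver.Path i j) (q : Quiver.Path j l) :
    pathElement b (p.comp q) = pathElement b q * pathElement b p := by
  induction q with
  | nil => exact (vertexIdem_mul_pathElement b p).symm
  | cons q a ih => rw [Quiver.Path.comp_cons, pathElement, ih, pathElement, mul_assoc]

theorem degreeZero_arrow_mul {i j : McKayQuiver E} {u : TensorSmash G}
    (hu : u ∈ arrowSpace E i j) (t : TensorSmash G) : degreeZero (u * t) = 0 := by
  rw [← sum_vector_mul_coordinate ((mem_arrowSpace_iff E).1 hu).1, Finset.sum_mul, map_sum]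
  exact Finset.sum_eq_zero fun x _ => by rw [mul_assoc, degreeZero_vector_mul]

end PathElement

variable [IsAlgClosed k] [Finite G]

/-- A linear form on `kG` that gives the coordinate of `e_i x e_i` on `e_i`. -/
def cornerForm (i : I) : k[G] →ₗ[k] k := (E.exists_cornerForm i).choose

theorem mul_mul_eq_cornerForm_smul (i : I) (x : k[G]) :
    E.e i * x * E.e i = cornerForm E i x • E.e i :=
  (E.exists_cornerForm i).choose_spec x

theorem cornerForm_self (i : I) : cornerForm E i (E.e i) = 1 := by
  have h := mul_mul_eq_cornerForm_smul E i (E.e i)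
  rw [(E.idem i).eq, (E.idem i).eq] at h
  exact smul_left_injective k (E.ne_zero i) (by simpa using h.symm)

theorem cornerForm_of_ne {i j : I} (h : i ≠ j) : cornerForm E i (E.e j) = 0 := by
  have h := mul_mul_eq_cornerForm_smul E i (E.e j)
  rw [E.mul_eq_zero ‹_›, zero_mul] at h
  exact (smul_eq_zero.1 h.symm).resolve_right (E.ne_zero i)

/-- The pairing of `r` and `u` by the corner form of `∑ r_x u_x` is non-degenerate in `u`: a
non-zero coordinate `u_x` generates the simple module `S_i`, so `r u_x = e_i` for some `r`. As the
arrow space is finite-dimensional, every linear form on it comes from some `r`. -/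
theorem exists_coefficients (i j : McKayQuiver E) (φ : Module.Dual k (arrowSpace E i j)) :
    ∃ r : Fin n → k[G], (∀ x, E.e i * r x = r x) ∧ ∀ u : arrowSpace E i j,
      ∑ x, r x * coordinate x (u : TensorSmash G) = φ u • E.e i := by
  let B : (Fin n → k[G]) →ₗ[k] Module.Dual k (arrowSpace E i j) :=
    LinearMap.mk₂ k (fun r u => ∑ x, cornerForm E i (r x * coordinate x (u : TensorSmash G)))
      (fun r s u => by simp [add_mul, Finset.sum_add_distrib])
      (fun c r u => by simp [Finset.mul_sum])
      (fun r u w => by simp [mul_add, Finset.sum_add_distrib])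
      (fun c r u => by simp [Finset.mul_sum])
  have hB (r u) : B r u = ∑ x, cornerForm E i (r x * coordinate x (u : TensorSmash G)) := rfl
  have hinj : Function.Injective B.flip := by
    rw [injective_iff_map_eq_zero]
    intro u hu
    have h0 (x : Fin n) : coordinate x (u : TensorSmash G) = 0 := by
      by_contra hne
      obtain ⟨r, hr⟩ := exists_mul_eq_of_isSimpleModule_span (E.simple i) (E.idem i)
        (coordinate_mul_idem E u.2 x) hne
      have h1 : B (Pi.single x r) u = 0 := LinearMap.congr_fun hu (Pi.single x r)
      rw [hB, Finset.sum_eq_single x (fun y _ hy => by simp [hy]) (by simp), Pi.single_eq_same,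
        hr, cornerForm_self E i] at h1
      exact one_ne_zero h1
    ext1
    rw [← sum_vector_mul_coordinate ((mem_arrowSpace_iff E).1 u.2).1]
    simp [h0]
  have hsurj : Function.Surjective B := 
    (@LinearMap.flip_injective_iff₁ k (Fin n → k[G]) (arrowSpace E i j) _ _ _ _ _ B _).1 hinj
  obtain ⟨r, rfl⟩ := hsurj φ
  -- Multiplying by `e_i` on the left puts the values into `e_i kG e_i = k e_i`, where the corner
  -- form determines them.
  refine ⟨fun x => E.e i * r x, fun x => by rw [← mul_assoc, (E.idem i).eq], fun u => ?_⟩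
  rw [hB, Finset.sum_smul]
  refine Finset.sum_congr rfl fun x _ => ?_
  refine Eq.trans ?_ (mul_mul_eq_cornerForm_smul E i (r x * coordinate x (u : TensorSmash G)))
  simp only [mul_assoc, coordinate_mul_idem E u.2 x]

/-- Elements of `kG` that pick out the arrow `a` among the elements of degree `1` that end in the
target of `a`. -/
def arrowCoefficients (b : ArrowBases E) {i j : McKayQuiver E} (a : i ⟶ j) : Fin n → k[G] :=
  (exists_coefficients E i j ((b i j).coord a)).choose

/-- Removal of the last arrow `a` of a path: paths that do not end in `a` are sent to `0`. -/
def removeArrow (b : ArrowBases E) {i j : McKayQuiver E} (a : i ⟶ j) :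
    TensorSmash G →ₗ[k] TensorSmash G :=
  ∑ x, LinearMap.mulLeft k (groupInclusion G (arrowCoefficients E b a x)) ∘ₗ
    smashDeriv (LinearMap.proj x) ∘ₗ LinearMap.mulLeft k (vertexIdem E j)

theorem removeArrow_apply (b : ArrowBases E) {i j : McKayQuiver E} (a : i ⟶ j)
    (t : TensorSmash G) :
    removeArrow E b a t = ∑ x, groupInclusion G (arrowCoefficients E b a x) *
      smashDeriv (LinearMap.proj x) (vertexIdem E j * t) := by
  simp [removeArrow]

theorem removeArrow_vertexIdem (b : ArrowBases E) {i j : McKayQuiver E} (a : i ⟶ j)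
    (l : McKayQuiver E) : removeArrow E b a (vertexIdem E l) = 0 := by
  rw [removeArrow_apply, vertexIdem_eq, vertexIdem_eq, ← map_mul]
  simp only [smashDeriv_groupInclusion, mul_zero, Finset.sum_const_zero]

theorem removeArrow_mul_of_target_ne (b : ArrowBases E) {i j l m : McKayQuiver E} (a : i ⟶ j)
    (h : j ≠ m) {u : TensorSmash G} (hu : u ∈ arrowSpace E l m) (t : TensorSmash G) :
    removeArrow E b a (u * t) = 0 := by
  rw [removeArrow_apply, ← ((mem_arrowSpace_iff E).1 hu).2.1, ← mul_assoc, ← mul_assoc,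
    vertexIdem_mul_eq_zero E h]
  simp

theorem removeArrow_mul (b : ArrowBases E) {i j l : McKayQuiver E} (a : i ⟶ j)
    {u : TensorSmash G} (hu : u ∈ arrowSpace E l j) (t : TensorSmash G) :
    removeArrow E b a (u * t) =
      groupInclusion G (∑ x, arrowCoefficients E b a x * coordinate x u) * t := by
  obtain ⟨h1, h2, -⟩ := (mem_arrowSpace_iff E).1 hu
  rw [removeArrow_apply, ← mul_assoc, h2, map_sum, Finset.sum_mul]
  refine Finset.sum_congr rfl fun x _ => ?_
  rw [smashDeriv_mul h1, map_mul, groupInclusion_coordinate h1, mul_assoc]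

theorem removeArrow_mul_of_source_ne (b : ArrowBases E) {i j l : McKayQuiver E} (a : i ⟶ j)
    (h : i ≠ l) {u : TensorSmash G} (hu : u ∈ arrowSpace E l j) (t : TensorSmash G) :
    removeArrow E b a (u * t) = 0 := by
  rw [removeArrow_mul E b a hu, Finset.sum_eq_zero, map_zero, zero_mul]
  intro x _
  have h1 : E.e i * arrowCoefficients E b a x = arrowCoefficients E b a x :=
    (exists_coefficients E i j ((b i j).coord a)).choose_spec.1 x
  rw [← coordinate_mul_idem E hu x, ← h1, ← mul_assoc]
  rw [mul_assoc (E.e i)]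
  exact E.mul_mul_eq_zero h _

/-- Together with the vanishing for other sources and targets, this makes `removeArrow` a left
division by the arrow `a`: the coordinate is `1` for `c = a` and `0` otherwise. -/
theorem removeArrow_arrow_mul (b : ArrowBases E) {i j : McKayQuiver E} (a c : i ⟶ j)
    (t : TensorSmash G) :
    removeArrow E b a ((b i j c : TensorSmash G) * t) =
      (b i j).coord a (b i j c) • (vertexIdem E i * t) := by
  rw [removeArrow_mul E b a (b i j c).2, vertexIdem_eq, ← smul_mul_assoc, ← map_smul]
  congr 2
  exact (exists_coefficients E i j ((b i j).coord a)).choose_spec.2 (b i j c)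

variable {E}

/-- The linear form on `T(V) ⊗ kG` that takes the coefficient on a given path. -/
def pathCoefficient (b : ArrowBases E) {i : McKayQuiver E} :
    ∀ {j : McKayQuiver E}, Quiver.Path i j → TensorSmash G →ₗ[k] k
  | _, .nil => cornerForm E i ∘ₗ degreeZero
  | _, .cons p a => pathCoefficient b p ∘ₗ removeArrow E b a

theorem pathCoefficient_self (b : ArrowBases E) {i j : McKayQuiver E} (p : Quiver.Path i j) :
    pathCoefficient b p (pathElement b p) = 1 := by
  induction p with
  | nil =>
    rw [pathCoefficient, pathElement, vertexIdem_eq, LinearMap.comp_apply,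
      degreeZero_groupInclusion]
    exact cornerForm_self E i
  | cons p a ih =>
    rw [pathCoefficient, pathElement, LinearMap.comp_apply, removeArrow_arrow_mul,
      vertexIdem_mul_pathElement, map_smul, ih]
    simp

/-- Arrows are stripped from both paths at once. If `q` is longer, a positive degree remains and
`degreeZero` kills it. If `q` is shorter, an idempotent remains and the derivative kills it. -/
theorem pathCoefficient_of_ne (b : ArrowBases E) {i j i' j' : McKayQuiver E}
    (p : Quiver.Path i j) (q : Quiver.Path i' j')
    (h : (⟨i, j, p⟩ : Σ i j : McKayQuiver E, Quiver.Path i j) ≠ ⟨i', j', q⟩) :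
    pathCoefficient b p (pathElement b q) = 0 := by
  induction p generalizing j' with
  | nil =>
    cases q with
    | nil =>
      rw [pathCoefficient, pathElement, vertexIdem_eq, LinearMap.comp_apply,
        degreeZero_groupInclusion]
      exact cornerForm_of_ne E (fun hi => h (by cases hi; rfl))
    | cons q a =>
      rw [pathCoefficient, pathElement, LinearMap.comp_apply, degreeZero_arrow_mul (b _ _ a).2,
        map_zero]
  | @cons l j p a ih =>
    cases q with
    | nil => rw [pathCoefficient, pathElement, LinearMap.comp_apply, removeArrow_vertexIdem,
        map_zero]
    | @cons l' _ q c =>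
      rw [pathCoefficient, pathElement, LinearMap.comp_apply]
      by_cases hj : j = j'
      swap
      · rw [removeArrow_mul_of_target_ne E b a hj (b _ _ c).2, map_zero]
      subst hj
      by_cases hl : l = l'
      swap
      · rw [removeArrow_mul_of_source_ne E b a hl (b _ _ c).2, map_zero]
      subst hl
      rw [removeArrow_arrow_mul, vertexIdem_mul_pathElement, map_smul]
      by_cases hc : c = a
      swap
      · rw [Module.Basis.coord_apply, Module.Basis.repr_self, Finsupp.single_eq_of_ne' hc,
          zero_smul]
      subst hc
      rw [ih q, smul_zero]
      intro hpq
      apply h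
      cases hpq
      rfl

theorem pathCoefficient_pathMap (b : ArrowBases E) (W : PathSpace E) {i j : McKayQuiver E}
    (p : Quiver.Path i j) : pathCoefficient b p (pathMap b W) = W ⟨i, j, p⟩ := by
  classical
  rw [pathMap, Finsupp.linearCombination_apply, Finsupp.sum, map_sum]
  simp only [map_smul]
  rw [Finset.sum_eq_single (⟨i, j, p⟩ : Σ i j : McKayQuiver E, Quiver.Path i j)]
  · rw [pathCoefficient_self, smul_eq_mul, mul_one]
  · rintro ⟨i', j', q⟩ _ hq
    rw [pathCoefficient_of_ne b p q hq.symm, smul_zero]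
  · intro h
    rw [Finsupp.notMem_support_iff.1 h, zero_smul]

/-- The path algebra of the McKay quiver embeds in `T(V) ⊗ kG`. -/
theorem pathMap_injective (b : ArrowBases E) : Function.Injective (pathMap b) := by
  intro W W' h
  ext ⟨i, j, p⟩
  rw [← pathCoefficient_pathMap b, ← pathCoefficient_pathMap b, h]

/-- Split off the first vector as `v s` and insert `1 = ∑ c e_l d` after it. Each term is `(e_j v c
e_l)(e_l d s e_i)`, an element of an arrow space times an element covered by the induction
hypothesis. -/
theorem mul_mul_mem_span_pathElement (b : ArrowBases E) {m : ℕ} {t : TensorSmash G}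
    (ht : t ∈ homogeneousPart k G m) (i j : McKayQuiver E) :
    vertexIdem E j * t * vertexIdem E i ∈ Submodule.span k
      {y | ∃ p : Quiver.Path i j, p.length = m ∧ y = pathElement b p} := by
  induction m generalizing t i j with
  | zero =>
    obtain ⟨a, rfl⟩ := exists_groupInclusion_eq ht
    rw [vertexIdem_eq, vertexIdem_eq, ← map_mul, ← map_mul]
    by_cases h : j = i
    · subst h
      rw [mul_mul_eq_cornerForm_smul E j, map_smul, ← vertexIdem_eq]
      exact Submodule.smul_mem _ _ (Submodule.subset_span ⟨.nil, rfl, rfl⟩)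
    · rw [E.mul_mul_eq_zero h, map_zero]
      exact zero_mem _
  | succ m ih =>
    induction ht using Submodule.span_induction with
    | zero => simp
    | add s t _ _ hs ht => rw [mul_add, add_mul]; exact add_mem hs ht
    | smul c t _ ht => rw [mul_smul_comm, smul_mul_assoc]; exact Submodule.smul_mem _ _ ht
    | mem t ht =>
      obtain ⟨g, x, rfl⟩ := ht
      rw [single_tprod_succ]
      generalize hs : (SkewMonoidAlgebra.single g (TensorAlgebra.tprod k (Fin n → k) m
        (Fin.tail x)) : TensorSmash G) = s
      have hs' : s ∈ homogeneousPart k G m := hs ▸ Submodule.subset_span ⟨g, _, rfl⟩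
      -- The invisible `1` between `v` and `s` is replaced by an arbitrary element of the span, so
      -- that the claim becomes linear in it.
      suffices H : ∀ a ∈ Submodule.span k {x : k[G] | ∃ i c d, x = c * E.e i * d},
          vertexIdem E j * (vector (x 0) * groupInclusion G a * s) * vertexIdem E i ∈
            Submodule.span k
              {y | ∃ p : Quiver.Path i j, p.length = m + 1 ∧ y = pathElement b p} by
        simpa using H 1 E.one_mem_span
      intro a ha
      induction ha using Submodule.span_induction with
      | zero => simp
      | add a a' _ _ ha ha' => simpa [mul_add, add_mul] using add_mem ha ha'
      | smul c a _ ha => simpa using Submodule.smul_mem _ c ha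
      | mem a ha =>
        obtain ⟨l', c, d, rfl⟩ := ha
        let l : McKayQuiver E := l'
        change vertexIdem E j * (vector (x 0) * groupInclusion G (c * E.e l * d) * s) *
          vertexIdem E i ∈ _
        have h1 := mul_mul_mem_arrowSpace E l j
          (mul_groupInclusion_mem_homogeneousPart c (vector_mem_homogeneousPart (x 0)))
        have h2 := ih (groupInclusion_mul_mem_homogeneousPart d hs') i l
        have h3 : vertexIdem E j * (vector (x 0) * groupInclusion G (c * E.e l * d) * s) *
            vertexIdem E i = (vertexIdem E j * (vector (x 0) * groupInclusion G c) *
              vertexIdem E l) * (vertexIdem E l * (groupInclusion G d * s) * vertexIdem E i) := by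
          rw [map_mul, map_mul, ← vertexIdem_eq E l]
          simp only [mul_assoc]
          rw [← mul_assoc (vertexIdem E l) (vertexIdem E l), vertexIdem_mul_self E l]
        rw [h3]
        generalize vertexIdem E l * (groupInclusion G d * s) * vertexIdem E i = y at h2
        generalize vertexIdem E j * (vector (x 0) * groupInclusion G c) * vertexIdem E l = w at h1
        have h4 : ((∑ a, (b l j).repr ⟨w, h1⟩ a • b l j a : arrowSpace E l j) : TensorSmash G) =
            w := congrArg Subtype.val ((b l j).sum_repr ⟨w, h1⟩)
        rw [← h4]
        induction h2 using Submodule.span_induction with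
        | zero => simp
        | add y y' _ _ hy hy' => rw [mul_add]; exact add_mem hy hy'
        | smul c y _ hy => rw [mul_smul_comm]; exact Submodule.smul_mem _ _ hy
        | mem y hy =>
          obtain ⟨p, hp, rfl⟩ := hy
          rw [AddSubmonoidClass.coe_finsetSum, Finset.sum_mul]
          refine sum_mem fun a _ => ?_
          rw [SetLike.val_smul, smul_mul_assoc]
          refine Submodule.smul_mem _ _ (Submodule.subset_span ⟨p.cons a, ?_, rfl⟩)
          rw [Quiver.Path.length_cons, hp]

end SkewMcKay

namespace SkewMcKay

/-! ### Block minors of permutation matrices -/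

section Shuffles

variable {k : Type u} [Field k]

theorem det_of_perm_apply {γ : Type*} [Fintype γ] [DecidableEq γ] (σ : Equiv.Perm γ)
    [∀ a c, Decidable (σ a = c)] :
    (Matrix.of fun a c => if σ a = c then (1 : k) else 0).det =
      ((Equiv.Perm.sign σ : ℤ) : k) := by
  rw [← Matrix.det_permutation]
  congr 1
  ext a c
  simp [PEquiv.toMatrix_apply, Equiv.toPEquiv_apply, eq_comm]

theorem cast_units_mul_self (x : ℤˣ) : ((x : ℤ) : k) * ((x : ℤ) : k) = 1 := by
  rw [← Int.cast_mul, Int.units_coe_mul_self, Int.cast_one]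

variable {α β : Type*} [Fintype α] [Fintype β] [DecidableEq α] [DecidableEq β]

variable (k) in
/-- The signed product of the two diagonal minors of a permutation matrix in block form. -/
def signedMinors (τ : Equiv.Perm (α ⊕ β)) : k :=
  ((Equiv.Perm.sign τ : ℤ) : k) *
    ((Matrix.of fun a c => if τ (Sum.inl a) = Sum.inl c then (1 : k) else 0).det *
      (Matrix.of fun a c => if τ (Sum.inr a) = Sum.inr c then (1 : k) else 0).det)

theorem signedMinors_sumCongr (σ₁ : Equiv.Perm α) (σ₂ : Equiv.Perm β) :
    signedMinors k (Equiv.Perm.sumCongr σ₁ σ₂) = 1 := by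
  simp only [signedMinors, Equiv.Perm.sumCongr_apply, Sum.map_inl, Sum.map_inr, Sum.inl.injEq,
    Sum.inr.injEq, Equiv.Perm.sign_sumCongr, Units.val_mul, Int.cast_mul]
  rw [det_of_perm_apply, det_of_perm_apply, mul_mul_mul_comm, cast_units_mul_self,
    cast_units_mul_self, mul_one]

/-- If `τ` preserves the left block, it is a sum `σ₁ ⊕ σ₂` and its sign cancels those of the two
minors. Otherwise the left minor has a zero row. -/
theorem signedMinors_eq_zero_or_one (τ : Equiv.Perm (α ⊕ β)) :
    signedMinors k τ = 0 ∨ signedMinors k τ = 1 := by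
  by_cases h : Set.MapsTo τ (Set.range Sum.inl) (Set.range Sum.inl)
  · right
    obtain ⟨⟨σ₁, σ₂⟩, rfl⟩ := Equiv.Perm.mem_sumCongrHom_range_of_perm_mapsTo_inl h
    exact signedMinors_sumCongr σ₁ σ₂
  · left
    simp only [Set.MapsTo, not_forall] at h
    obtain ⟨-, ⟨a, rfl⟩, ha⟩ := h
    have h0 : (Matrix.of fun a c => if τ (Sum.inl a) = Sum.inl c then (1 : k) else 0).det = 0 :=
      Matrix.det_eq_zero_of_row_eq_zero a fun c => if_neg fun hc => ha ⟨c, hc.symm⟩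
    rw [signedMinors, h0, zero_mul, mul_zero]

variable (k α β) in
theorem sum_signedMinors_ne_zero [CharZero k] :
    ∑ τ : Equiv.Perm (α ⊕ β), signedMinors k τ ≠ 0 := by
  have h (τ : Equiv.Perm (α ⊕ β)) : ∃ N : ℕ, signedMinors k τ = N :=
    (signedMinors_eq_zero_or_one τ).elim (fun h => ⟨0, by rw [h, Nat.cast_zero]⟩)
      (fun h => ⟨1, by rw [h, Nat.cast_one]⟩)
  choose N hN using h
  have h1 : N 1 = 1 := by
    have := hN 1
    rw [← Equiv.Perm.sumCongr_one, signedMinors_sumCongr] at this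
    rw [← Equiv.Perm.sumCongr_one]
    exact_mod_cast this.symm
  simp only [hN]
  rw [← Nat.cast_sum, Nat.cast_ne_zero]
  exact (Finset.sum_pos' (fun _ _ => Nat.zero_le _) ⟨1, Finset.mem_univ _, by omega⟩).ne'

end Shuffles

/-! ### Multilinear forms as linear forms on `T(V)` -/

section TensorForm

variable {k : Type u} [Field k] {n : ℕ} {G : Subgroup (Matrix.SpecialLinearGroup (Fin n) k)}

theorem mem_span_tprod (x : TensorAlgebra k (Fin n → k)) :
    x ∈ Submodule.span k {y | ∃ (m : ℕ) (v : Fin m → Fin n → k),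
      y = TensorAlgebra.tprod k (Fin n → k) m v} := by
  induction x using TensorAlgebra.induction with
  | algebraMap r =>
    rw [Algebra.algebraMap_eq_smul_one]
    exact Submodule.smul_mem _ _ (Submodule.subset_span ⟨0, ![], by simp⟩)
  | ι v => exact Submodule.subset_span ⟨1, ![v], by simp⟩
  | add a b ha hb => exact add_mem ha hb
  | mul a b ha hb =>
    induction ha, hb using Submodule.span_induction₂ with
    | mem_mem s t hs ht =>
      obtain ⟨_, x, rfl⟩ := hs
      obtain ⟨_, y, rfl⟩ := ht
      exact Submodule.subset_span ⟨_, _, tprod_mul_tprod x y⟩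
    | zero_left => simp
    | zero_right => simp
    | add_left x y z _ _ _ h1 h2 => rw [add_mul]; exact add_mem h1 h2
    | add_right x y z _ _ _ h1 h2 => rw [mul_add]; exact add_mem h1 h2
    | smul_left r x y _ _ h => rw [smul_mul_assoc]; exact Submodule.smul_mem _ _ h
    | smul_right r x y _ _ h => rw [mul_smul_comm]; exact Submodule.smul_mem _ _ h

/-- The linear form on `T(V)` which is given by a multilinear form in degree `m` and vanishes in
all other degrees. -/
def tensorForm {m : ℕ} (F : MultilinearMap k (fun _ : Fin m => Fin n → k) k) :
    TensorAlgebra k (Fin n → k) →ₗ[k] k :=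
  PiTensorProduct.lift F ∘ₗ DirectSum.component k ℕ (fun i => ⨂[k]^i (Fin n → k)) m ∘ₗ
    TensorAlgebra.toDirectSum.toLinearMap

theorem tensorForm_tprod {m : ℕ} (F : MultilinearMap k (fun _ : Fin m => Fin n → k) k)
    (v : Fin m → Fin n → k) :
    tensorForm F (TensorAlgebra.tprod k (Fin n → k) m v) = F v := by
  rw [tensorForm, LinearMap.comp_apply, LinearMap.comp_apply, AlgHom.toLinearMap_apply,
    TensorAlgebra.toDirectSum_tensorPower_tprod, ← DirectSum.lof_eq_of k,
    DirectSum.component.lof_self, PiTensorProduct.lift.tprod]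

theorem tensorForm_tprod_of_ne {m l : ℕ} (h : l ≠ m)
    (F : MultilinearMap k (fun _ : Fin m => Fin n → k) k) (v : Fin l → Fin n → k) :
    tensorForm F (TensorAlgebra.tprod k (Fin n → k) l v) = 0 := by
  rw [tensorForm, LinearMap.comp_apply, LinearMap.comp_apply, AlgHom.toLinearMap_apply,
    TensorAlgebra.toDirectSum_tensorPower_tprod, ← DirectSum.lof_eq_of k,
    DirectSum.component.of, dif_neg h, map_zero]

theorem tensorForm_smul {m : ℕ} {F : MultilinearMap k (fun _ : Fin m => Fin n → k) k} {g : G}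
    (hF : ∀ v, F (fun i => givenRep G g (v i)) = F v) (x : TensorAlgebra k (Fin n → k)) :
    tensorForm F (g • x) = tensorForm F x := by
  induction mem_span_tprod x using Submodule.span_induction with
  | mem x hx =>
    obtain ⟨l, v, rfl⟩ := hx
    rw [smul_tprod]
    by_cases h : l = m
    · subst h
      rw [tensorForm_tprod, tensorForm_tprod, hF]
    · rw [tensorForm_tprod_of_ne h, tensorForm_tprod_of_ne h]
  | zero => simp
  | add x y _ _ hx hy => rw [smul_add, map_add, map_add, hx, hy]
  | smul c x _ hx => rw [smul_comm, map_smul _ c, map_smul _ c, hx]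

/-- The product of two multilinear forms, in separate sets of variables. -/
def mulForm {a b : ℕ} (F₁ : MultilinearMap k (fun _ : Fin a => Fin n → k) k)
    (F₂ : MultilinearMap k (fun _ : Fin b => Fin n → k) k) :
    MultilinearMap k (fun _ : Fin (a + b) => Fin n → k) k :=
  ((LinearMap.mul' k k).compMultilinearMap (F₁.domCoprod F₂)).domDomCongr finSumFinEquiv

theorem mulForm_apply {a b : ℕ} (F₁ : MultilinearMap k (fun _ : Fin a => Fin n → k) k)
    (F₂ : MultilinearMap k (fun _ : Fin b => Fin n → k) k) (v : Fin (a + b) → Fin n → k) :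
    mulForm F₁ F₂ v =
      F₁ (fun i => v (Fin.castAdd b i)) * F₂ (fun i => v (Fin.natAdd a i)) := by
  simp [mulForm]

/-- In `(x ⊗ g)(y ⊗ h) = x g(y) ⊗ gh` the twist by `g` only affects the argument of `F₂`, where
invariance removes it. -/
theorem formExtension_mulForm {a b : ℕ} {F₁ : MultilinearMap k (fun _ : Fin a => Fin n → k) k}
    {F₂ : MultilinearMap k (fun _ : Fin b => Fin n → k) k}
    (hF₂ : ∀ (g : G) v, F₂ (fun i => givenRep G g (v i)) = F₂ v) {s t : TensorSmash G}
    (hs : s ∈ homogeneousPart k G a) (ht : t ∈ homogeneousPart k G b) :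
    formExtension (tensorForm (mulForm F₁ F₂)) (s * t) =
      formExtension (tensorForm F₁) s * formExtension (tensorForm F₂) t := by
  induction hs, ht using Submodule.span_induction₂ with
  | mem_mem s t hs ht =>
    obtain ⟨g, x, rfl⟩ := hs
    obtain ⟨h, y, rfl⟩ := ht
    rw [single_mul_single', smul_tprod, tprod_mul_tprod, formExtension_single,
      formExtension_single, formExtension_single, tensorForm_tprod, tensorForm_tprod,
      tensorForm_tprod, mulForm_apply, MonoidAlgebra.single_mul_single]
    simp [hF₂]
  | zero_left => simp
  | zero_right => simp
  | add_left x y z _ _ _ h1 h2 => simp only [add_mul, map_add, h1, h2]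
  | add_right x y z _ _ _ h1 h2 => simp only [mul_add, map_add, h1, h2]
  | smul_left r x y _ _ h => simp only [smul_mul_assoc, map_smul, h]
  | smul_right r x y _ _ h => simp only [mul_smul_comm, map_smul, h]

theorem tensorForm_omega (F : MultilinearMap k (fun _ : Fin n => Fin n → k) k) :
    tensorForm F (omega k n) = ((Equiv.Perm.sign (Fin.revPerm (n := n)) : ℤ) : k) *
      MultilinearMap.alternatization F (fun i => Pi.single i 1) := by
  rw [omega, map_sum, MultilinearMap.alternatization_apply, Finset.mul_sum]
  -- In `ω` the basis vectors stand in reversed order. Substituting `σ ∘ rev` for `σ` restores the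
  -- order of the alternatization at the cost of the sign of `rev`.
  refine Fintype.sum_equiv (Equiv.mulRight Fin.revPerm) _ _ fun σ => ?_
  rw [map_smul, tensorForm_tprod]
  simp only [Equiv.coe_mulRight, Equiv.Perm.sign_mul, Units.smul_def, Units.val_mul,
    MultilinearMap.domDomCongr_apply, Equiv.Perm.coe_mul, Function.comp_apply, zsmul_eq_mul,
    Int.cast_mul, smul_eq_mul, Fin.revPerm_apply]
  linear_combination (norm := ring_nf) (-((Equiv.Perm.sign σ : ℤ) : k) *
    F (fun i => Pi.single (σ (Fin.rev i)) 1)) *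
      cast_units_mul_self (k := k) (Equiv.Perm.sign Fin.revPerm)

end TensorForm

/-! ### Determinants of blocks of coordinates -/

section BlockForm

variable {k : Type u} [Field k]

/-- The determinant of the coordinates given by `e` of the images of vectors under `P`. -/
def blockForm {ι κ : Type*} [Fintype ι] [DecidableEq ι] [Fintype κ] [DecidableEq κ]
    (P : Matrix ι ι k) (e : κ → ι) : MultilinearMap k (fun _ : κ => ι → k) k :=
  (Matrix.detRowAlternating.compLinearMap
    (LinearMap.funLeft k k e ∘ₗ P.mulVecLin)).toMultilinearMap

theorem blockForm_apply {ι κ : Type*} [Fintype ι] [DecidableEq ι] [Fintype κ] [DecidableEq κ]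
    (P : Matrix ι ι k) (e : κ → ι) (v : κ → ι → k) :
    blockForm P e v = (Matrix.of fun b a => (P *ᵥ v b) (e a)).det := rfl

theorem blockForm_mulVec {ι κ : Type*} [Fintype ι] [DecidableEq ι] [Fintype κ] [DecidableEq κ]
    {P g : Matrix ι ι k} {e : κ → ι} {A : Matrix κ κ k} (hA : A.det = 1)
    (h : ∀ v a, (P *ᵥ (g *ᵥ v)) (e a) = (A *ᵥ fun b => (P *ᵥ v) (e b)) a) (v : κ → ι → k) :
    blockForm P e (fun i => g *ᵥ v i) = blockForm P e v := by
  rw [blockForm_apply, blockForm_apply]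
  have : (Matrix.of fun b a => (P *ᵥ (g *ᵥ v b)) (e a)) =
      (Matrix.of fun b a => (P *ᵥ v b) (e a)) * Aᵀ := by
    ext b a
    rw [Matrix.of_apply, h, Matrix.mul_apply]
    exact Finset.sum_congr rfl fun _ _ => mul_comm _ _
  rw [this, Matrix.det_mul, Matrix.det_transpose, hA, mul_one]

/-- An alternating form of top degree is non-zero on one basis as soon as it is non-zero at all. It
is tested on the columns of `P⁻¹`, where each block determinant becomes a minor of a permutation
matrix and the sum is that of `signedMinors`. -/
theorem alternatization_mulForm_ne_zero [CharZero k] {a b : ℕ} (P : GL (Fin (a + b)) k) :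
    MultilinearMap.alternatization
      (mulForm (blockForm (P : Matrix (Fin (a + b)) (Fin (a + b)) k) (Fin.castAdd b))
        (blockForm (P : Matrix (Fin (a + b)) (Fin (a + b)) k) (Fin.natAdd a)))
      (fun i => Pi.single i 1) ≠ 0 := by
  have hb := AlternatingMap.map_basis_ne_zero_iff (Pi.basisFun k (Fin (a + b)))
    (MultilinearMap.alternatization
      (mulForm (blockForm (P : Matrix (Fin (a + b)) (Fin (a + b)) k) (Fin.castAdd b))
        (blockForm (P : Matrix (Fin (a + b)) (Fin (a + b)) k) (Fin.natAdd a))))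
  have hb' : (Pi.basisFun k (Fin (a + b)) : Fin (a + b) → Fin (a + b) → k) =
      fun i => Pi.single i 1 := by
    ext i : 1
    simp
  rw [hb'] at hb
  refine hb.2 fun h0 => ?_
  have h1 := congrArg (fun f => f (fun i =>
    ((P⁻¹ : GL (Fin (a + b)) k) : Matrix (Fin (a + b)) (Fin (a + b)) k) *ᵥ Pi.single i 1)) h0
  simp only [AlternatingMap.zero_apply, MultilinearMap.alternatization_apply] at h1
  refine sum_signedMinors_ne_zero k (Fin a) (Fin b) (Eq.trans ?_ h1)
  refine Fintype.sum_equiv finSumFinEquiv.permCongr _ _ fun τ => ?_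
  have hP (v : Fin (a + b) → k) : (P : Matrix (Fin (a + b)) (Fin (a + b)) k) *ᵥ
      (((P⁻¹ : GL (Fin (a + b)) k) : Matrix (Fin (a + b)) (Fin (a + b)) k) *ᵥ v) = v := by
    rw [Matrix.mulVec_mulVec, ← Units.val_mul, mul_inv_cancel, Units.val_one, Matrix.one_mulVec]
  have hl (i : Fin a) : Fin.castAdd b i = finSumFinEquiv (Sum.inl i) := by simp
  have hr (i : Fin b) : Fin.natAdd a i = finSumFinEquiv (Sum.inr i) := by simp
  simp only [signedMinors, MultilinearMap.domDomCongr_apply, mulForm_apply, blockForm_apply, hP,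
    Units.smul_def, zsmul_eq_mul, Equiv.Perm.sign_permCongr, Pi.single_apply, hl, hr, Equiv.permCongr_apply,
    Equiv.symm_apply_apply, EmbeddingLike.apply_eq_iff_eq, eq_comm]

end BlockForm

end SkewMcKay

namespace SkewMcKay

/-! ### The path expansion of the superpotential -/

section Superpotential

variable {k : Type u} [Field k] {n : ℕ} {G : Subgroup (Matrix.SpecialLinearGroup (Fin n) k)}
  {I : Type v} (E : IrrepIdempotents G I)

section PathElement

variable {E}

theorem pathElement_mul_vertexIdem_of_ne (b : ArrowBases E) {i j l : McKayQuiver E}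
    (p : Quiver.Path i j) (h : i ≠ l) : pathElement b p * vertexIdem E l = 0 := by
  rw [← pathElement_mul_vertexIdem b p, mul_assoc, vertexIdem_mul_eq_zero E h, mul_zero]

theorem vertexIdem_mul_pathElement_of_ne (b : ArrowBases E) {i j l : McKayQuiver E}
    (p : Quiver.Path i j) (h : l ≠ j) : vertexIdem E l * pathElement b p = 0 := by
  rw [← vertexIdem_mul_pathElement b p, ← mul_assoc, vertexIdem_mul_eq_zero E h, zero_mul]

end PathElement

variable [Fintype I]

instance fintypeMcKayQuiver : Fintype (McKayQuiver E) := inferInstanceAs (Fintype I)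

theorem groupInclusion_sum_idem :
    groupInclusion G (∑ i, E.e i) = ∑ i : McKayQuiver E, vertexIdem E i := by
  rw [map_sum]
  exact Finset.sum_congr rfl fun i _ => (vertexIdem_eq E i).symm

theorem vertexIdem_mul_superpotential_mul (j : McKayQuiver E) :
    vertexIdem E j * superpotential E * vertexIdem E j =
      vertexIdem E j * SkewMonoidAlgebra.single 1 (omega k n) * vertexIdem E j := by
  classical
  have hl : vertexIdem E j * groupInclusion G (∑ i, E.e i) = vertexIdem E j := by
    rw [groupInclusion_sum_idem, Finset.mul_sum, Finset.sum_eq_single j]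
    · exact vertexIdem_mul_self E j
    · exact fun i _ h => vertexIdem_mul_eq_zero E h.symm
    · simp
  have hr : groupInclusion G (∑ i, E.e i) * vertexIdem E j = vertexIdem E j := by
    rw [groupInclusion_sum_idem, Finset.sum_mul, Finset.sum_eq_single j]
    · exact vertexIdem_mul_self E j
    · exact fun i _ h => vertexIdem_mul_eq_zero E h
    · simp
  rw [superpotential, ofGroupAlgebra_eq, ← mul_assoc, ← mul_assoc, hl,
    mul_assoc _ _ (vertexIdem E j), hr]

theorem single_omega_mem_homogeneousPart :
    (SkewMonoidAlgebra.single 1 (omega k n) : TensorSmash G) ∈ homogeneousPart k G n := by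
  have h : (SkewMonoidAlgebra.single 1 (omega k n) : TensorSmash G) =
      ∑ σ : Equiv.Perm (Fin n), ((Equiv.Perm.sign σ : ℤ) : k) • SkewMonoidAlgebra.single 1
        (TensorAlgebra.tprod k (Fin n → k) n (fun i => Pi.single (σ (Fin.rev i)) (1 : k))) := by
    simp only [SkewMonoidAlgebra.smul_single]
    exact map_sum (SkewMonoidAlgebra.singleAddHom 1) _ _
  rw [h]
  exact sum_mem fun σ _ => Submodule.smul_mem _ _ (Submodule.subset_span ⟨1, _, rfl⟩)

variable {E}

/-- The lengths are recorded because every path that occurs is later cut into pieces of lengths `n₁`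
and `n₂`. -/
theorem exists_pathMap_eq_superpotential [IsAlgClosed k] [Finite G] (b : ArrowBases E) :
    ∃ W : PathSpace E, pathMap b W = superpotential E ∧
      ∀ p, W p ≠ 0 → p.2.2.length = n := by
  have h : superpotential E ∈ Submodule.span k
      ((fun p : Σ i j : McKayQuiver E, Quiver.Path i j => pathElement b p.2.2) ''
        {p | p.2.2.length = n}) := by
    rw [superpotential, ofGroupAlgebra_eq, groupInclusion_sum_idem, Finset.sum_mul,
      Finset.sum_mul]
    refine sum_mem fun j _ => ?_
    rw [Finset.mul_sum]
    refine sum_mem fun i _ => ?_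
    refine Submodule.span_mono ?_
      (mul_mul_mem_span_pathElement b (single_omega_mem_homogeneousPart (G := G)) i j)
    rintro y ⟨p, hp, rfl⟩
    exact ⟨⟨i, j, p⟩, hp, rfl⟩
  obtain ⟨W, hW, hWs⟩ := (Finsupp.mem_span_image_iff_linearCombination k).1 h
  exact ⟨W, hWs, fun p hp => hW (Finsupp.mem_support_iff.2 hp)⟩

end Superpotential

/-! ### Closed paths that return to their source -/

section Loops

variable {k : Type u} [Field k] {n₁ n₂ : ℕ}
  {G : Subgroup (Matrix.SpecialLinearGroup (Fin (n₁ + n₂)) k)} {I : Type v}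
  {E : IrrepIdempotents G I}

/-- A product of invariant multilinear forms vanishes on paths that do not pass through their
source again. -/
theorem formExtension_pathElement_comp (b : ArrowBases E)
    {F₁ : MultilinearMap k (fun _ : Fin n₁ => Fin (n₁ + n₂) → k) k}
    {F₂ : MultilinearMap k (fun _ : Fin n₂ => Fin (n₁ + n₂) → k) k}
    (hF₁ : ∀ (g : G) v, F₁ (fun i => givenRep G g (v i)) = F₁ v)
    (hF₂ : ∀ (g : G) v, F₂ (fun i => givenRep G g (v i)) = F₂ v) {j l : McKayQuiver E}
    (h : l ≠ j) {p₂ : Quiver.Path j l} {p₁ : Quiver.Path l j} (hp₁ : p₁.length = n₁)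
    (hp₂ : p₂.length = n₂) :
    formExtension (tensorForm (mulForm F₁ F₂)) (pathElement b (p₂.comp p₁)) = 0 := by
  have h₁ := pathElement_mem_homogeneousPart b p₁
  have h₂ := pathElement_mem_homogeneousPart b p₂
  rw [hp₁] at h₁
  rw [hp₂] at h₂
  rw [pathElement_comp, formExtension_mulForm hF₂ h₁ h₂, ← vertexIdem_mul_pathElement b p₁,
    ← vertexIdem_mul_pathElement b p₂, vertexIdem_eq, vertexIdem_eq,
    formExtension_groupInclusion_mul (fun g x => tensorForm_smul (hF₁ g) x),
    formExtension_groupInclusion_mul (fun g x => tensorForm_smul (hF₂ g) x), ← mul_assoc]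
  exact mul_eq_zero_of_left (E.mul_mul_eq_zero (Ne.symm h) _) _

/-- Under the extension of `F₁F₂`, `e_j ω e_j` has the non-zero value `F(ω) e_j`. If all
coefficients in question were `0`, each path in the expansion would contribute `0`. -/
theorem exists_loops [Fintype I] [IsAlgClosed k] [Finite G] (b : ArrowBases E) {W : PathSpace E}
    (hW : pathMap b W = superpotential E) (hWn : ∀ p, W p ≠ 0 → p.2.2.length = n₁ + n₂)
    {F₁ : MultilinearMap k (fun _ : Fin n₁ => Fin (n₁ + n₂) → k) k}
    {F₂ : MultilinearMap k (fun _ : Fin n₂ => Fin (n₁ + n₂) → k) k}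
    (hF₁ : ∀ (g : G) v, F₁ (fun i => givenRep G g (v i)) = F₁ v)
    (hF₂ : ∀ (g : G) v, F₂ (fun i => givenRep G g (v i)) = F₂ v)
    (hF : tensorForm (mulForm F₁ F₂) (omega k (n₁ + n₂)) ≠ 0) (j : McKayQuiver E) :
    ∃ p₁ p₂ : Quiver.Path j j,
      p₁.length = n₁ ∧ p₂.length = n₂ ∧ W ⟨j, j, p₂.comp p₁⟩ ≠ 0 := by
  by_contra! h
  have hinv (g : G) (x) : tensorForm (mulForm F₁ F₂) (g • x) = tensorForm (mulForm F₁ F₂) x :=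
    tensorForm_smul (fun v => by simp only [mulForm_apply]; rw [hF₁ g, hF₂ g]) x
  have h1 := congrArg (formExtension (tensorForm (mulForm F₁ F₂)))
    (vertexIdem_mul_superpotential_mul E j)
  have h2 : formExtension (tensorForm (mulForm F₁ F₂)) (vertexIdem E j *
      SkewMonoidAlgebra.single 1 (omega k (n₁ + n₂)) * vertexIdem E j) =
      tensorForm (mulForm F₁ F₂) (omega k (n₁ + n₂)) • E.e j := by
    rw [vertexIdem_eq, formExtension_mul_groupInclusion, formExtension_groupInclusion_mul hinv,
      formExtension_single]
    have h3 (c : k) : (MonoidAlgebra.single 1 c : k[G]) = c • 1 := by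
      simp [MonoidAlgebra.one_def]
    rw [h3, mul_smul_comm, smul_mul_assoc, mul_one, (E.idem j).eq]
  rw [h2, ← hW, pathMap, Finsupp.linearCombination_apply, Finsupp.sum, Finset.mul_sum,
    Finset.sum_mul, map_sum] at h1
  refine (smul_ne_zero hF (E.ne_zero j)) (h1.symm.trans (Finset.sum_eq_zero ?_))
  rintro ⟨i', j', p⟩ hp
  have hlen : p.length = n₁ + n₂ := hWn _ (Finsupp.mem_support_iff.1 hp)
  rw [mul_smul_comm, smul_mul_assoc, map_smul]
  by_cases hj : j = j'
  swap
  · rw [vertexIdem_mul_pathElement_of_ne b p hj, zero_mul, map_zero, smul_zero]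
  subst hj
  by_cases hi : i' = j
  swap
  · rw [mul_assoc, pathElement_mul_vertexIdem_of_ne b p hi, mul_zero, map_zero, smul_zero]
  subst hi
  rw [vertexIdem_mul_pathElement, pathElement_mul_vertexIdem]
  -- The first `n₂` arrows are cut off: they form the right factor of the product, on which `F₂` is
  -- evaluated.
  obtain ⟨l, p₂, p₁, rfl, hp₂⟩ := p.exists_eq_comp_of_le_length (n := n₂) (by omega)
  have hp₁ : p₁.length = n₁ := by
    rw [Quiver.Path.length_comp] at hlen
    omega
  by_cases hl : l = i'
  · subst hl
    exact (Finsupp.mem_support_iff.1 hp (h p₁ p₂ hp₁ hp₂)).elim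
  · rw [formExtension_pathElement_comp b hF₁ hF₂ hl hp₁ hp₂, smul_zero]

end Loops

/-! ### Invariant forms of a block diagonal group -/

section Blocks

variable {k : Type u} [Field k] {n₁ n₂ : ℕ}

theorem mulVec_mulVec_of_conj {ι : Type*} [Fintype ι] [DecidableEq ι] {P : GL ι k}
    {g B : Matrix ι ι k} (h : (P : Matrix ι ι k) * g * ((P⁻¹ : GL ι k) : Matrix ι ι k) = B)
    (v : ι → k) : (P : Matrix ι ι k) *ᵥ (g *ᵥ v) = B *ᵥ ((P : Matrix ι ι k) *ᵥ v) := by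
  rw [Matrix.mulVec_mulVec, Matrix.mulVec_mulVec, ← h, mul_assoc, ← Units.val_mul,
    inv_mul_cancel, Units.val_one, mul_one]

/-- A group of block diagonal matrices with blocks of determinant `1` leaves the determinants of
the blocks of coordinates invariant. -/
theorem exists_invariant_forms [CharZero k]
    {G : Subgroup (Matrix.SpecialLinearGroup (Fin (n₁ + n₂)) k)}
    (hG : EmbedsInProduct G n₁ n₂ rfl) :
    ∃ (F₁ : MultilinearMap k (fun _ : Fin n₁ => Fin (n₁ + n₂) → k) k)
      (F₂ : MultilinearMap k (fun _ : Fin n₂ => Fin (n₁ + n₂) → k) k),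
      (∀ (g : G) v, F₁ (fun i => givenRep G g (v i)) = F₁ v) ∧
      (∀ (g : G) v, F₂ (fun i => givenRep G g (v i)) = F₂ v) ∧
      tensorForm (mulForm F₁ F₂) (omega k (n₁ + n₂)) ≠ 0 := by
  obtain ⟨P, hP⟩ := hG
  have hg (g : G) (v : Fin (n₁ + n₂) → k) :
      givenRep G g v = g.1.1 *ᵥ v :=
    Matrix.toLin'_apply _ _
  simp only [hg]
  refine ⟨blockForm P (Fin.castAdd n₂), blockForm P (Fin.natAdd n₁), fun g v => ?_,
    fun g v => ?_, ?_⟩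
  · obtain ⟨g₁, g₂, h⟩ := hP g g.2
    refine blockForm_mulVec g₁.2 (fun v a => ?_) v
    rw [mulVec_mulVec_of_conj h]
    simp [Matrix.mulVec, dotProduct, Fin.sum_univ_add]
  · obtain ⟨g₁, g₂, h⟩ := hP g g.2
    refine blockForm_mulVec g₂.2 (fun v a => ?_) v
    rw [mulVec_mulVec_of_conj h]
    simp [Matrix.mulVec, dotProduct, Fin.sum_univ_add]
  · rw [tensorForm_omega]
    refine mul_ne_zero ?_ (alternatization_mulForm_ne_zero P)
    exact Int.cast_ne_zero.2 (Units.ne_zero _)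

end Blocks

end SkewMcKay

end

theorem mainTheorem11 {k : Type u} [Field k] [IsAlgClosed k] [CharZero k]
    {n n₁ n₂ : ℕ} (hn₁ : 1 ≤ n₁) (hn₂ : 1 ≤ n₂) (hn : n₁ + n₂ = n)
    (G : Subgroup (Matrix.SpecialLinearGroup (Fin n) k)) [Finite G]
    (hG : SkewMcKay.EmbedsInProduct G n₁ n₂ hn)
    {I : Type v} [Fintype I] (E : SkewMcKay.IrrepIdempotents G I) :
    Nonempty (SkewMcKay.ArrowBases E) ∧
    ∀ b : SkewMcKay.ArrowBases E,
      ∃ W : SkewMcKay.PathSpace E,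
        SkewMcKay.pathMap b W = SkewMcKay.superpotential E ∧
        (∀ W' : SkewMcKay.PathSpace E,
          SkewMcKay.pathMap b W' = SkewMcKay.superpotential E → W' = W) ∧
        ∀ j : SkewMcKay.McKayQuiver E, ∃ p₁ p₂ : Quiver.Path j j,
          p₁.length = n₁ ∧ p₂.length = n₂ ∧ W ⟨j, j, p₂.comp p₁⟩ ≠ 0 := by
  subst hn
  obtain ⟨F₁, F₂, hF₁, hF₂, hF⟩ := SkewMcKay.exists_invariant_forms hG
  refine ⟨SkewMcKay.nonempty_arrowBases E, fun b => ?_⟩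
  obtain ⟨W, hW, hWn⟩ := SkewMcKay.exists_pathMap_eq_superpotential b
  exact ⟨W, hW, fun W' h => SkewMcKay.pathMap_injective b (h.trans hW.symm),
    SkewMcKay.exists_loops b hW hWn hF₁ hF₂ hF⟩
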